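/- Let $U=(U_n)_{n\ge0}$ be a positional numeration system: a strictly increasing sequence of integers with $U_0=1$ and bounded quotients $U_{n+1}/U_n$. Write $\mathrm{rep}_U(x)$ for the greedy $U$-representation of $x\in\mathbb N$, most significant digit first. Suppose that $U$ has an associated alternate base $(\beta_0,\dots,\beta_{p-1})$, $p\ge1$, i.e. $\lim_{n\to\infty}U_{np-i}/U_{np-i-1}=\beta_i$ for $0\le i<p$; indices of $\beta$ are read modulo $p$. For $0\le i<p$ let $\mathbf d_i=t_{i,0}t_{i,1}\cdots$ be the greedy expansion of $1$ in the base $(\beta_i,\beta_{i+1},\dots,\beta_{i+p-1})$: $r_0=1$, $t_{i,n}=\lfloor\beta_{i+n}r_n\rfloor$, $r_{n+1}=\beta_{i+n}r_n-t_{i,n}$. If $\mathbf d_i$ is finite (ends in zeros only), let $\ell_i$ be its length up to the last nonzero digit, put $\sigma(i)=(i+\ell_i)\bmod p$, and for all large $n$ let $$(\Delta_i)_n=U_{np-i}-\sum_{\ell=1}^{\ell_i}t_{i,\ell-1}U_{np-i-\ell}.$$ As long as the iterates of $\sigma$ involved exist, let $k_{i,j}=\sum_{h=0}^{j-1}\ell_{\sigma^h(i)}$,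 define $m_{i,j}$ by $\sigma^j(i)=i+k_{i,j}-m_{i,j}p$, and put $(\Delta_i^{(j)})_n=\sum_{h=0}^{j-1}(\Delta_{\sigma^h(i)})_{n-m_{i,h}}$. For $0\le i<p$ and $c\ge1$ let $L_i=\{\mathrm{rep}_U(U_{np-i}-1):n\ge1\}$ and $L_{i,c}=\{\mathrm{rep}_{i,c}(n):n\ge1,\ U_{np-i}\ge c\}$, where $\mathrm{rep}_{i,c}(n)$ is $\mathrm{rep}_U(U_{np-i}-c)$ padded with leading zeros to length $np-i$. **Theorem.** Let $i\in\{0,\dots,p-1\}$ and let $s,r\ge1$ be such that $\mathbf d_i,\mathbf d_{\sigma(i)},\dots,\mathbf d_{\sigma^{s+r-1}(i)}$ are finite and $\sigma^{s+r}(i)=\sigma^s(i)$, with $s$ minimal (that is, for no $s'<s$ is there an $r'\ge1$ with $\sigma^{s'+r'}(i)=\sigma^{s'}(i)$). Assume that * the languages $L_{\sigma(i)},\dots,L_{\sigma^{s+r-1}(i)}$ are regular; * $M,M'\ge1$ are integers with $Mp=M'k_{\sigma^s(i),r}$; * for $0\le j<s$, the sequence $\big((\Delta_{\sigma^j(i)})_{n+M}-(\Delta_{\sigma^j(i)})_n\big)_n$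 is ultimately periodic with period $M$; * for $s\le j<s+r$, the sequence $\Delta_{\sigma^j(i)}$ is ultimately periodic with period $M$. (Periods need not be least.) For $0\le e<M$ and $0\le j<s$ let $\Gamma_{i,e,j}$ be the ultimate constant value, as $n\to\infty$, of $(\Delta_{\sigma^j(i)})_{nM+e-m_{i,j}}-(\Delta_{\sigma^j(i)})_{(n-1)M+e-m_{i,j}}$, and for $0\le e'<M$ let $\Delta^{(M'r)}_{\sigma^s(i),e'}$ be the ultimate constant value of $(\Delta^{(M'r)}_{\sigma^s(i)})_{nM+e'}$. Then the following are equivalent: (a) $L_i$ is regular; (b) $L_{i,c}$ is regular for every $c\ge1$; (c) for every $e\in\{0,\dots,M-1\}$, either $\Gamma_{i,e,0}=0$, or both of the following hold: $\Gamma_{i,e,0}=-\Delta^{(M'r)}_{\sigma^s(i),e'}<0$, where $e'=(e-m_{i,s})\bmod M$, and $\Gamma_{i,e,j}=0$ for all $j\in\{1,\dots,s-1\}$. -/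

import Mathlib

open Filter Topology

namespace NumerationSystem

/-- A positional numeration system: an increasing sequence of integers with `U 0 = 1` and
uniformly bounded quotients `U (n + 1) / U n`. -/
structure IsPositionalSystem (U : ℕ → ℕ) : Prop where
  strictMono : StrictMono U
  zero : U 0 = 1
  bounded : ∃ C : ℝ, ∀ n, (U (n + 1) : ℝ) / (U n : ℝ) ≤ C

/-- The digits `a_{n-1} ⋯ a_0` (most significant first) produced by the greedy algorithm in the
system `U` started at position `n - 1` on the remainder `x`. -/
def greedyDigits (U : ℕ → ℕ) : ℕ → ℕ → List ℕ
  | 0, _ => []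
  | n + 1, x => (x / U n) :: greedyDigits U n (x % U n)

/-- The greedy `U`-representation of `x`: the algorithm starts from the least `ℓ` with
`x < U ℓ`. -/
noncomputable def rep (U : ℕ → ℕ) (x : ℕ) : List ℕ :=
  greedyDigits U (sInf {l | x < U l}) x

/-- The word `rep_{i,c}(n)`: the greedy representation of `U_{np-i} - c`, padded with leading zeros
to length `np - i`. It is used only for `i < p`, `1 ≤ n` and `1 ≤ c ≤ U_{np-i}`. -/
noncomputable def repShift (U : ℕ → ℕ) (p i c n : ℕ) : List ℕ :=
  (rep U (U (n * p - i) - c)).leftpad (n * p - i) 0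

/-- The language `L_i = {rep_U(U_{np-i} - 1) : n ≥ 1}`. Words are over `ℕ`, but only finitely many
letters occur in them; a language over a finite set of letters is regular over that set if and only
if it is accepted by a deterministic automaton with finitely many states over `ℕ`. -/
def lang (U : ℕ → ℕ) (p i : ℕ) : Language ℕ :=
  {w | ∃ n, 1 ≤ n ∧ w = rep U (U (n * p - i) - 1)}

/-- The language `L_{i,c} = {rep_{i,c}(n) : n ≥ 1, U_{np-i} ≥ c}`. -/
def langShift (U : ℕ → ℕ) (p i c : ℕ) : Language ℕ :=
  {w | ∃ n, 1 ≤ n ∧ c ≤ U (n * p - i) ∧ w = repShift U p i c n}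

/-- `(β 0, …, β (p - 1))` is an alternate base associated with `U`. The values `β n` with `p ≤ n`
are irrelevant, here and below. -/
def IsAssociatedBase (U : ℕ → ℕ) (p : ℕ) (β : ℕ → ℝ) : Prop :=
  1 ≤ p ∧ ∀ i < p,
    Tendsto (fun n : ℕ => (U (n * p - i) : ℝ) / (U (n * p - i - 1) : ℝ)) atTop (𝓝 (β i))

/-- The remainders in the greedy expansion of `1` in the shifted base
`B^{(i)} = (β_i, …, β_{i+p-1})`, with indices taken modulo `p`. -/
noncomputable def greedyRem (p : ℕ) (β : ℕ → ℝ) (i : ℕ) : ℕ → ℝ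
  | 0 => 1
  | n + 1 => Int.fract (β ((i + n) % p) * greedyRem p β i n)

/-- The digit `t_{i,n}` of the greedy `B^{(i)}`-expansion `d_i` of `1`. (For the base `(1)` this
gives `1 0 0 ⋯`, as it should.) -/
noncomputable def digit (p : ℕ) (β : ℕ → ℝ) (i n : ℕ) : ℕ :=
  ⌊β ((i + n) % p) * greedyRem p β i n⌋₊

/-- The expansion `d_i` is finite: it ends in a tail of zeros. -/
def FiniteExpansion (p : ℕ) (β : ℕ → ℝ) (i : ℕ) : Prop :=
  ∃ L, ∀ n, L ≤ n → digit p β i n = 0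

/-- The length `ℓ_i` of a finite expansion `d_i`, up to its last nonzero digit. -/
noncomputable def expLength (p : ℕ) (β : ℕ → ℝ) (i : ℕ) : ℕ :=
  sInf {L | ∀ n, L ≤ n → digit p β i n = 0}

/-- The successor `σ(i) = (i + ℓ_i) mod p` of the vertex `i`; meaningful only if `d_i` is finite. -/
noncomputable def succVertex (p : ℕ) (β : ℕ → ℝ) (i : ℕ) : ℕ :=
  (i + expLength p β i) % p

/-- `σ^j(i)`. -/
noncomputable def vertex (p : ℕ) (β : ℕ → ℝ) (i j : ℕ) : ℕ :=
  (succVertex p β)^[j] i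

/-- The vertices `i, σ(i), …, σ^{s+r}(i)` exist, `r ≥ 1`, and `σ^{s+r}(i) = σ^s(i)`. -/
def ReachesCycle (p : ℕ) (β : ℕ → ℝ) (i s r : ℕ) : Prop :=
  1 ≤ r ∧ (∀ j < s + r, FiniteExpansion p β (vertex p β i j)) ∧
    vertex p β i (s + r) = vertex p β i s

/-- The vertex `i` is not itself in a cycle, and reaches one after exactly `s ≥ 1` steps:
`σ^{s+r}(i) = σ^s(i)` with `s` minimal. -/
def LeadsToCycle (p : ℕ) (β : ℕ → ℝ) (i s r : ℕ) : Prop :=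
  1 ≤ s ∧ ReachesCycle p β i s r ∧ ∀ s' < s, ∀ r', ¬ ReachesCycle p β i s' r'

/-- `k_{i,j} = ℓ_i + ℓ_{σ(i)} + ⋯ + ℓ_{σ^{j-1}(i)}`. -/
noncomputable def kLen (p : ℕ) (β : ℕ → ℝ) (i j : ℕ) : ℕ :=
  ∑ h ∈ Finset.range j, expLength p β (vertex p β i h)

/-- `m_{i,j}`, determined by `σ^j(i) = i + k_{i,j} - m_{i,j} p`. -/
noncomputable def mShift (p : ℕ) (β : ℕ → ℝ) (i j : ℕ) : ℕ :=
  (i + kLen p β i j) / p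

theorem vertex_add_mShift_mul (p : ℕ) (β : ℕ → ℝ) (i j : ℕ) (hi : i < p) :
    vertex p β i j + mShift p β i j * p = i + kLen p β i j := by
  have h : vertex p β i j = (i + kLen p β i j) % p := by
    induction j with
    | zero => simp [vertex, kLen, Nat.mod_eq_of_lt hi]
    | succ j ih =>
      have h1 : vertex p β i (j + 1) = succVertex p β (vertex p β i j) := by
        simp only [vertex, Function.iterate_succ_apply']
      have h2 : kLen p β i (j + 1) = kLen p β i j + expLength p β (vertex p β i j) := by
        simp only [kLen, Finset.sum_range_succ]
      rw [h1, h2, succVertex, ih, Nat.mod_add_mod, add_assoc]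
  rw [h, mShift, mul_comm]
  exact Nat.mod_add_div _ _

/-- `(Δ_i)_n = U_{np-i} - ∑_{ℓ=1}^{ℓ_i} t_{i,ℓ-1} U_{np-i-ℓ}`, meaningful for `np - i ≥ ℓ_i`. -/
noncomputable def delta (U : ℕ → ℕ) (p : ℕ) (β : ℕ → ℝ) (i n : ℕ) : ℤ :=
  (U (n * p - i) : ℤ) -
    ∑ l ∈ Finset.Icc 1 (expLength p β i), (digit p β i (l - 1) : ℤ) * (U (n * p - i - l) : ℤ)

/-- `(Δ_i^{(j)})_n = ∑_{h=0}^{j-1} (Δ_{σ^h(i)})_{n - m_{i,h}}`, meaningful for `np - i ≥ k_{i,j}`. -/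
noncomputable def deltaSum (U : ℕ → ℕ) (p : ℕ) (β : ℕ → ℝ) (i j n : ℕ) : ℤ :=
  ∑ h ∈ Finset.range j, delta U p β (vertex p β i h) (n - mShift p β i h)

/-- The sequence `x` is ultimately periodic with period `M` (not necessarily the least one). -/
def UltPeriodic (x : ℕ → ℤ) (M : ℕ) : Prop :=
  ∃ N, ∀ n, N ≤ n → x (n + M) = x n

/-- The sequence `(x_{n+M} - x_n)_n` is ultimately periodic with period `M`. -/
def UltPeriodicDiff (x : ℕ → ℤ) (M : ℕ) : Prop :=
  UltPeriodic (fun n => x (n + M) - x n) M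

open Classical in
/-- The ultimate constant value of an ultimately constant sequence (and `0` for any other). -/
noncomputable def eventualValue (x : ℕ → ℤ) : ℤ :=
  if h : ∃ v, ∀ᶠ n in atTop, x n = v then h.choose else 0

theorem eventualValue_eq {x : ℕ → ℤ} {v : ℤ} (h : ∀ᶠ n in atTop, x n = v) :
    eventualValue x = v := by
  have hex : ∃ v, ∀ᶠ n in atTop, x n = v := ⟨v, h⟩
  rw [eventualValue, dif_pos hex]
  obtain ⟨n, h1, h2⟩ := (hex.choose_spec.and h).exists
  exact h1.symm.trans h2

/-- `Δ^{(j)}_{i,e}`: the ultimate constant value of `(Δ_i^{(j)})_{nM+e}` as `n` grows. -/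
noncomputable def deltaSumValue (U : ℕ → ℕ) (p : ℕ) (β : ℕ → ℝ) (M i j e : ℕ) : ℤ :=
  eventualValue fun n => deltaSum U p β i j (n * M + e)

/-- `Γ_{i,e,j}`: the ultimate constant value of
`(Δ_{σ^j(i)})_{nM+e-m_{i,j}} - (Δ_{σ^j(i)})_{(n-1)M+e-m_{i,j}}` as `n` grows. -/
noncomputable def gamma (U : ℕ → ℕ) (p : ℕ) (β : ℕ → ℝ) (M i e j : ℕ) : ℤ :=
  eventualValue fun n =>
    delta U p β (vertex p β i j) (n * M + e - mShift p β i j) -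
      delta U p β (vertex p β i j) ((n - 1) * M + e - mShift p β i j)

/-- The residue `(e - m) mod M` in `{0, …, M - 1}`. -/
def residue (M e m : ℕ) : ℕ :=
  (((e : ℤ) - (m : ℤ)) % (M : ℤ)).toNat

/-- An ultimately `M`-periodic sequence is ultimately constant on each residue class. -/
theorem UltPeriodic.exists_eventually {x : ℕ → ℤ} {M : ℕ} (hM : 1 ≤ M) (hx : UltPeriodic x M)
    (e m : ℕ) : ∃ v, ∀ᶠ n in atTop, x (n * M + e - m) = v := by
  obtain ⟨N, hN⟩ := hx
  refine ⟨x ((N + m) * M + e - m), eventually_atTop.2 ⟨N + m, fun n hn => ?_⟩⟩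
  induction n, hn using Nat.le_induction with
  | base => rfl
  | succ n hn ih =>
    have h1 : N + m ≤ n * M := hn.trans (Nat.le_mul_of_pos_right n hM)
    have h2 : (n + 1) * M + e - m = (n * M + e - m) + M := by
      rw [Nat.succ_mul]; omega
    rw [h2, hN _ (by omega), ih]

/-- Where the differences of `Δ_{σ^j(i)}` are ultimately `M`-periodic, `Γ_{i,e,j}` is a genuine
ultimate value. -/
theorem gamma_spec (U : ℕ → ℕ) (p : ℕ) (β : ℕ → ℝ) (M i e j : ℕ) (hM : 1 ≤ M)
    (h : UltPeriodicDiff (delta U p β (vertex p β i j)) M) :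
    ∀ᶠ n in atTop, delta U p β (vertex p β i j) (n * M + e - mShift p β i j) -
      delta U p β (vertex p β i j) ((n - 1) * M + e - mShift p β i j) = gamma U p β M i e j := by
  obtain ⟨v, hv⟩ := UltPeriodic.exists_eventually hM h e (mShift p β i j)
  have key : ∀ᶠ n in atTop, delta U p β (vertex p β i j) (n * M + e - mShift p β i j) -
      delta U p β (vertex p β i j) ((n - 1) * M + e - mShift p β i j) = v := by
    obtain ⟨N, hN⟩ := eventually_atTop.1 hv
    refine eventually_atTop.2 ⟨N + mShift p β i j + 1, fun n hn => ?_⟩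
    obtain ⟨n, rfl⟩ : ∃ k, n = k + 1 := ⟨n - 1, by omega⟩
    have h1 : mShift p β i j ≤ n * M := by
      have := Nat.le_mul_of_pos_right n hM
      omega
    have h2 : (n + 1) * M + e - mShift p β i j = (n * M + e - mShift p β i j) + M := by
      rw [Nat.succ_mul]; omega
    rw [h2, Nat.add_sub_cancel]
    exact hN n (by omega)
  rw [gamma, eventualValue_eq key]
  exact key

/-- Where the sequences `Δ_{σ^h(i)}` are ultimately `M`-periodic, `Δ^{(j)}_{i,e}` is a genuine
ultimate value. -/
theorem deltaSumValue_spec (U : ℕ → ℕ) (p : ℕ) (β : ℕ → ℝ) (M i j e : ℕ) (hM : 1 ≤ M)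
    (h : ∀ h < j, UltPeriodic (delta U p β (vertex p β i h)) M) :
    ∀ᶠ n in atTop, deltaSum U p β i j (n * M + e) = deltaSumValue U p β M i j e := by
  have hex : ∃ v, ∀ᶠ n in atTop, deltaSum U p β i j (n * M + e) = v := by
    choose! v hv using fun k (hk : k < j) =>
      UltPeriodic.exists_eventually hM (h k hk) e (mShift p β i k)
    refine ⟨∑ k ∈ Finset.range j, v k, ?_⟩
    have hall : ∀ᶠ n in atTop, ∀ k ∈ Finset.range j,
        delta U p β (vertex p β i k) (n * M + e - mShift p β i k) = v k :=
      (Finset.eventually_all _).2 fun k hk => hv k (Finset.mem_range.1 hk)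
    filter_upwards [hall] with n hn
    exact Finset.sum_congr rfl hn
  obtain ⟨v, hv⟩ := hex
  rw [deltaSumValue, eventualValue_eq hv]
  exact hv

end NumerationSystem

open NumerationSystem

/-! Consider the greedy word of U_N - c, and call c the deficit. At N = np - v with d_v finite, U_N
- c is the value of the digits of d_v plus Δ_v - c. If c > Δ_v, a unit is borrowed from the last
digit and the algorithm continues on U_{N-ℓ_v} with deficit c - Δ_v, at the vertex σ(v)
(`coword_down`). If c ≤ Δ_v, it writes d_v and only the number Δ_v - c is left (`coword_up`). Both
hold for large n: the tail of d_v from k ≥ 1 on is asymptotically r_k U_{N-k} with r_k < 1, and U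
grows exponentially while c and Δ_v are affine.

For n in a residue class e modulo M, the Δ's met along the path are affine in n, with slope
Γ_{i,e,j} before the cycle and 0 on it. On the cycle, M'r passes consume Mp digits, hence lead from
n + 1 back to n, and lower the deficit by a constant G (`gain`). A deficit with coefficient a that
stays positive thus writes the same word y in every round, and its constant term, read at the new n,
changes by a - G (`descend_cycle`).

Necessity: L_i has one word per length np - i, so by pumping the tails after y^q and y^{q'} agree
for some q < q', which forces a = G (`eq_gain`). With y a block of zeros this excludes positive
slopes (`slope_nonpos`). A negative slope makes a positive up to the cycle, so the slopes sum to -G,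
and downward induction along the path leaves only one nonzero slope (`slopeCondition`).

Sufficiency: regularity on the cycle gives G ≥ 0 (`gain_nonneg`), and then every deficit c produces
words x y^k z (`eventuallyPowers`), so L_{i,c} is a finite set together with finitely many languages
x y^* z. The case c = 1 is L_i. -/

namespace Language

/-! ### Closure properties and pumping for regular languages -/

open scoped Computability

variable {α : Type*}

/-- A language belonging to a finite family of languages that is closed under left quotients by
letters is regular. -/
theorem IsRegular.of_finite_family {L : Language α} (F : Set (Language α)) (hF : F.Finite)
    (hL : L ∈ F) (h : ∀ K ∈ F, ∀ a, K.leftQuotient [a] ∈ F) : L.IsRegular := by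
  refine IsRegular.of_finite_range_leftQuotient (hF.subset ?_)
  rintro _ ⟨w, rfl⟩
  induction w using List.reverseRecOn with
  | nil => exact hL
  | append_singleton w a ih => rw [leftQuotient_append]; exact h _ ih a

theorem leftQuotient_mem_range {L K : Language α} (hK : K ∈ Set.range L.leftQuotient) (a : α) :
    K.leftQuotient [a] ∈ Set.range L.leftQuotient := by
  obtain ⟨w, rfl⟩ := hK
  exact ⟨w ++ [a], leftQuotient_append L w [a]⟩

/-- Every left quotient of LK has the form AK ∪ ⋃S, with A a quotient of L and S a set of quotients
of K; reading a letter adds a quotient of K to S when A contains the empty word. -/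
theorem IsRegular.mul {L K : Language α} (hL : L.IsRegular) (hK : K.IsRegular) :
    (L * K).IsRegular := by
  have hL' := hL.finite_range_leftQuotient
  have hK' := hK.finite_range_leftQuotient
  let f : Language α × Set (Language α) → Language α :=
    fun q => {w | w ∈ q.1 * K ∨ ∃ J ∈ q.2, w ∈ J}
  refine IsRegular.of_finite_family
    (f '' (Set.range L.leftQuotient ×ˢ 𝒫 (Set.range K.leftQuotient)))
    ((hL'.prod hK'.finite_subsets).image f)
    ⟨(L, ∅), ⟨⟨[], rfl⟩, Set.empty_subset _⟩, ?_⟩ ?_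
  · ext w
    change (w ∈ L * K ∨ ∃ J ∈ (∅ : Set (Language α)), w ∈ J) ↔ _
    simp
  · rintro _ ⟨⟨A, S⟩, ⟨hA, hS⟩, rfl⟩ a
    refine ⟨(A.leftQuotient [a],
      (fun J : Language α => J.leftQuotient [a]) '' (S ∪ {J | J = K ∧ [] ∈ A})),
      ⟨leftQuotient_mem_range hA a, ?_⟩, ?_⟩
    · rintro _ ⟨J, hJ | ⟨rfl, -⟩, rfl⟩
      · exact leftQuotient_mem_range (hS hJ) a
      · exact leftQuotient_mem_range ⟨[], rfl⟩ a
    · ext w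
      change (w ∈ A.leftQuotient [a] * K ∨ ∃ J ∈ _, w ∈ J) ↔
        (a :: w ∈ A * K ∨ ∃ J ∈ S, a :: w ∈ J)
      constructor
      · rintro (h | ⟨_, ⟨J, hJ | ⟨rfl, hJ⟩, rfl⟩, hw⟩)
        · obtain ⟨u, hu, v, hv, rfl⟩ := mem_mul.1 h
          exact Or.inl (mem_mul.2 ⟨a :: u, hu, v, hv, rfl⟩)
        · exact Or.inr ⟨J, hJ, hw⟩
        · exact Or.inl (mem_mul.2 ⟨[], hJ, a :: w, hw, rfl⟩)
      · rintro (h | ⟨J, hJ, hw⟩)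
        · obtain ⟨u, hu, v, hv, huv⟩ := mem_mul.1 h
          cases u with
          | nil =>
            simp only [List.nil_append] at huv
            subst huv
            exact Or.inr ⟨_, ⟨K, Or.inr ⟨rfl, hu⟩, rfl⟩, hv⟩
          | cons b u =>
            simp only [List.cons_append, List.cons.injEq] at huv
            obtain ⟨rfl, rfl⟩ := huv
            exact Or.inl (mem_mul.2 ⟨u, hu, v, hv, rfl⟩)
        · exact Or.inr ⟨_, ⟨J, Or.inl hJ, rfl⟩, hw⟩

/-- Apart from L∗ itself, the quotients have the form (⋃S) L∗ with S a set of quotients of L. -/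
theorem IsRegular.kstar {L : Language α} (hL : L.IsRegular) : (L∗).IsRegular := by
  have hL' := hL.finite_range_leftQuotient
  let g : Set (Language α) → Language α := fun S => {w | ∃ J ∈ S, w ∈ J}
  let f : Set (Language α) → Language α := fun S => g S * L∗
  have hstar : ∀ a w, a :: w ∈ L∗ → w ∈ L.leftQuotient [a] * L∗ := by
    intro a w hw
    obtain ⟨l, hl, hmem⟩ := mem_kstar_iff_exists_nonempty.1 hw
    cases l with
    | nil => simp at hl
    | cons u l =>
      obtain ⟨hu, hne⟩ := hmem u (by simp)
      cases u with
      | nil => exact absurd rfl hne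
      | cons b u =>
        simp only [List.flatten_cons, List.cons_append, List.cons.injEq] at hl
        obtain ⟨rfl, rfl⟩ := hl
        exact mem_mul.2 ⟨u, hu, l.flatten, join_mem_kstar fun y hy => (hmem y (by simp [hy])).1, rfl⟩
  have hcons : ∀ a w, w ∈ L.leftQuotient [a] * L∗ → a :: w ∈ L∗ := by
    intro a w hw
    obtain ⟨u, hu, v, hv, rfl⟩ := mem_mul.1 hw
    rw [← one_add_self_mul_kstar_eq_kstar]
    exact Or.inr (mem_mul.2 ⟨a :: u, hu, v, hv, rfl⟩)
  refine IsRegular.of_finite_family (insert L∗ (f '' 𝒫 (Set.range L.leftQuotient)))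
    ((hL'.finite_subsets.image f).insert _) (Set.mem_insert _ _) ?_
  rintro _ (rfl | ⟨S, hS, rfl⟩) a
  · refine Or.inr ⟨{L.leftQuotient [a]}, ?_, ?_⟩
    · rintro _ rfl; exact ⟨[a], rfl⟩
    · have hg : g {L.leftQuotient [a]} = L.leftQuotient [a] := by
        ext w
        change (∃ J ∈ ({L.leftQuotient [a]} : Set (Language α)), w ∈ J) ↔ _
        simp
      ext w
      change w ∈ g _ * L∗ ↔ a :: w ∈ L∗
      rw [hg]
      exact ⟨hcons a w, hstar a w⟩
  · refine Or.inr ⟨(fun J : Language α => J.leftQuotient [a]) '' (S ∪ {J | J = L ∧ [] ∈ g S}),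
      ?_, ?_⟩
    · rintro _ ⟨J, hJ | ⟨rfl, -⟩, rfl⟩
      · exact leftQuotient_mem_range (hS hJ) a
      · exact leftQuotient_mem_range ⟨[], rfl⟩ a
    · ext w
      change w ∈ g _ * L∗ ↔ a :: w ∈ g S * L∗
      constructor
      · intro h
        obtain ⟨u, ⟨_, ⟨J, hJ | ⟨rfl, hJ⟩, rfl⟩, hu⟩, v, hv, rfl⟩ := mem_mul.1 h
        · exact mem_mul.2 ⟨a :: u, ⟨J, hJ, hu⟩, v, hv, rfl⟩
        · exact mem_mul.2 ⟨[], hJ, a :: (u ++ v), hcons a _ (mem_mul.2 ⟨u, hu, v, hv, rfl⟩), rfl⟩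
      · intro h
        obtain ⟨u, hu, v, hv, huv⟩ := mem_mul.1 h
        cases u with
        | nil =>
          simp only [List.nil_append] at huv
          subst huv
          obtain ⟨u', hu', v', hv', rfl⟩ := mem_mul.1 (hstar a w hv)
          exact mem_mul.2 ⟨u', ⟨_, ⟨L, Or.inr ⟨rfl, hu⟩, rfl⟩, hu'⟩, v', hv', rfl⟩
        | cons b u =>
          simp only [List.cons_append, List.cons.injEq] at huv
          obtain ⟨rfl, rfl⟩ := huv
          obtain ⟨J, hJ, hu⟩ := hu
          exact mem_mul.2 ⟨u, ⟨_, ⟨J, Or.inl hJ, rfl⟩, hu⟩, v, hv, rfl⟩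

theorem IsRegular.singleton (w : List α) : IsRegular ({w} : Set (List α)) := by
  have hfin : {v : List α | v <:+ w}.Finite := by
    refine (List.finite_toSet w.tails).subset fun v hv => ?_
    simpa using hv
  refine IsRegular.of_finite_family (L := ({w} : Set (List α)))
    (insert (∅ : Set (List α)) ((fun v => ({v} : Set (List α))) '' {v | v <:+ w}))
    ((hfin.image _).insert _) (Or.inr ⟨w, List.suffix_rfl, rfl⟩) ?_
  rintro _ (rfl | ⟨v, hv, rfl⟩) a
  · exact Or.inl rfl
  · by_cases h : ∃ u, v = a :: u
    · obtain ⟨u, rfl⟩ := h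
      refine Or.inr ⟨u, (List.suffix_cons a u).trans hv, ?_⟩
      ext x
      change x = u ↔ a :: x = a :: u
      simp
    · left
      refine Set.eq_empty_of_forall_notMem fun x hx => h ⟨x, ?_⟩
      exact (show a :: x = v from hx).symm

theorem IsRegular.biUnion {ι : Type*} {s : Set ι} (hs : s.Finite) (f : ι → Set (List α))
    (hf : ∀ i ∈ s, IsRegular (f i)) : IsRegular (⋃ i ∈ s, f i) := by
  induction s, hs using Set.Finite.induction_on with
  | empty =>
    have : (⋃ i ∈ (∅ : Set ι), f i) = ∅ := by simp
    rw [this]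
    exact IsRegular.of_finite_family {(∅ : Set (List α))} (Set.finite_singleton _) rfl
      (by rintro _ rfl a; rfl)
  | @insert i s _ _ ih =>
    rw [Set.biUnion_insert]
    exact (hf i (by simp)).add (ih fun j hj => hf j (by simp [hj]))

/-- The language `x y^* z` is regular. -/
theorem IsRegular.range_flatten_replicate (x y z : List α) :
    IsRegular (Set.range fun n : ℕ => x ++ (List.replicate n y).flatten ++ z) := by
  have key : ∀ A B C : Language α, (∀ w, w ∈ A ↔ w = x) → (∀ w, w ∈ B ↔ w = y) →
      (∀ w, w ∈ C ↔ w = z) → ∀ w, w ∈ A * B∗ * C ↔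
        ∃ n : ℕ, x ++ (List.replicate n y).flatten ++ z = w := by
    intro A B C hA hB hC w
    simp only [mem_mul, mem_kstar, hA, hB, hC]
    constructor
    · rintro ⟨_, ⟨_, rfl, _, ⟨l, rfl, hl⟩, rfl⟩, _, rfl, rfl⟩
      exact ⟨l.length, by rw [← List.eq_replicate_of_mem hl]⟩
    · rintro ⟨n, rfl⟩
      exact ⟨_, ⟨x, rfl, _, ⟨_, rfl, fun v hv => (List.mem_replicate.1 hv).2⟩, rfl⟩, z, rfl, rfl⟩
  have h := ((IsRegular.singleton x).mul (IsRegular.singleton y).kstar).mul (IsRegular.singleton z)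
  refine (congrArg IsRegular (Language.ext fun w => ?_)).mp h
  exact key _ _ _ (fun _ => Iff.rfl) (fun _ => Iff.rfl) (fun _ => Iff.rfl) w

/-- Long powers of a fixed word can be pumped in a regular language, by an exponent depending on
the language only. -/
theorem IsRegular.exists_pump {L : Language α} (hL : L.IsRegular) :
    ∃ K a : ℕ, 1 ≤ a ∧ ∀ u y v : List α, ∀ q, K ≤ q →
      u ++ (List.replicate q y).flatten ++ v ∈ L →
      u ++ (List.replicate (q + a) y).flatten ++ v ∈ L := by
  obtain ⟨σ, _, M, rfl⟩ := hL
  classical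
  -- There are finitely many self-maps of the state set, so two exponents act alike on all of them
  -- at once; this makes the pumping constants independent of the word y.
  obtain ⟨m, n, hmn, h⟩ : ∃ m n : ℕ, m < n ∧ ∀ f : σ → σ, f^[m] = f^[n] := by
    obtain ⟨m, n, hne, h⟩ := Finite.exists_ne_map_eq_of_infinite
      (fun (n : ℕ) (f : σ → σ) => f^[n])
    rcases lt_or_gt_of_ne hne with hlt | hlt
    · exact ⟨m, n, hlt, fun f => congrFun h f⟩
    · exact ⟨n, m, hlt, fun f => (congrFun h f).symm⟩
  have hrep : ∀ (q : ℕ) (s : σ) (y : List α),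
      M.evalFrom s (List.replicate q y).flatten = (fun t => M.evalFrom t y)^[q] s := by
    intro q
    induction q with
    | zero => intro s y; rfl
    | succ q ih =>
      intro s y
      rw [List.replicate_succ, List.flatten_cons, DFA.evalFrom_of_append, ih,
        Function.iterate_succ_apply]
  refine ⟨m, n - m, by omega, fun u y v q hq hmem => ?_⟩
  have hiter : ∀ f : σ → σ, f^[q + (n - m)] = f^[q] := by
    intro f
    have h1 : q + (n - m) = (q - m) + n := by omega
    have h2 : q = (q - m) + m := by omega
    rw [h1, Function.iterate_add, ← h, ← Function.iterate_add, ← h2]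
  rw [DFA.mem_accepts, DFA.eval] at hmem ⊢
  rw [DFA.evalFrom_of_append, DFA.evalFrom_of_append, hrep] at hmem ⊢
  rw [hiter]
  exact hmem

end Language

/-! ### Greedy words -/

namespace NumerationSystem

variable {U : ℕ → ℕ}

theorem IsPositionalSystem.pos (hU : IsPositionalSystem U) (n : ℕ) : 0 < U n := by
  have := hU.strictMono.monotone (Nat.zero_le n)
  rw [hU.zero] at this
  exact this

@[simp]
theorem length_greedyDigits (U : ℕ → ℕ) (N x : ℕ) : (greedyDigits U N x).length = N := by
  induction N generalizing x with
  | zero => rfl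
  | succ N ih => simp [greedyDigits, ih]

theorem greedyDigits_injOn (hU : IsPositionalSystem U) {N x y : ℕ} (hx : x < U N) (hy : y < U N)
    (h : greedyDigits U N x = greedyDigits U N y) : x = y := by
  induction N generalizing x y with
  | zero => rw [hU.zero] at hx hy; omega
  | succ N ih =>
    simp only [greedyDigits, List.cons.injEq] at h
    have h2 := ih (Nat.mod_lt _ (hU.pos N)) (Nat.mod_lt _ (hU.pos N)) h.2
    rw [← Nat.div_add_mod x (U N), ← Nat.div_add_mod y (U N), h.1, h2]

theorem greedyDigits_add_of_lt (hU : IsPositionalSystem U) {N x : ℕ} (Q : ℕ) (hx : x < U N) :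
    greedyDigits U (N + Q) x = List.replicate Q 0 ++ greedyDigits U N x := by
  induction Q with
  | zero => simp
  | succ Q ih =>
    have h : x < U (N + Q) := hx.trans_le (hU.strictMono.monotone (Nat.le_add_right N Q))
    rw [← add_assoc, greedyDigits, Nat.div_eq_of_lt h, Nat.mod_eq_of_lt h, ih]
    rfl

/-- If every tail of the digit string `t 0 ⋯ t (k - 1)`, together with the remainder `y`, is
smaller than the term of `U` in front of it, then the greedy algorithm outputs this string. -/
theorem greedyDigits_sum_add (t : ℕ → ℕ) (N k y : ℕ) (hk : k ≤ N)
    (h : ∀ a, 1 ≤ a → a ≤ k → ∑ l ∈ Finset.Ico a k, t l * U (N - l - 1) + y < U (N - a)) :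
    greedyDigits U N (∑ l ∈ Finset.range k, t l * U (N - l - 1) + y) =
      (List.range k).map t ++ greedyDigits U (N - k) y := by
  induction k generalizing t N with
  | zero => simp
  | succ k ih =>
    obtain ⟨N, rfl⟩ : ∃ N', N = N' + 1 := ⟨N - 1, by omega⟩
    have hshift : ∀ a, ∑ l ∈ Finset.Ico (a + 1) (k + 1), t l * U (N + 1 - l - 1) =
        ∑ l ∈ Finset.Ico a k, t (l + 1) * U (N - l - 1) := by
      intro a
      rw [← Finset.sum_Ico_add' (fun l => t l * U (N + 1 - l - 1)) a k 1]
      refine Finset.sum_congr rfl fun l _ => ?_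
      rw [Nat.add_sub_add_right]
    have h1 := h 1 le_rfl (by omega)
    rw [show (1 : ℕ) = 0 + 1 from rfl, hshift, ← Finset.range_eq_Ico] at h1
    simp only [zero_add, Nat.add_sub_cancel] at h1
    have h2 : ∑ l ∈ Finset.range (k + 1), t l * U (N + 1 - l - 1) + y =
        t 0 * U N + (∑ l ∈ Finset.range k, t (l + 1) * U (N - l - 1) + y) := by
      rw [Finset.sum_range_succ', add_comm _ (t 0 * _), add_assoc]
      congr 2
      refine Finset.sum_congr rfl fun l _ => ?_
      rw [Nat.add_sub_add_right]
    have h3 := ih (fun l => t (l + 1)) N (by omega) (by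
      intro a ha hak
      have := h (a + 1) (by omega) (by omega)
      rw [hshift, Nat.add_sub_add_right] at this
      exact this)
    have hpos : 0 < U N := (Nat.zero_le _).trans_lt h1
    rw [h2, greedyDigits, mul_comm, Nat.mul_add_div hpos, Nat.div_eq_of_lt h1, Nat.mul_add_mod,
      Nat.mod_eq_of_lt h1, h3, List.range_succ_eq_map]
    simp [Function.comp_def]

/-- The greedy word of length `N` of `U N - c`. -/
noncomputable def coword (U : ℕ → ℕ) (N : ℕ) (c : ℤ) : List ℕ :=
  greedyDigits U N ((U N : ℤ) - c).toNat

@[simp]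
theorem length_coword (U : ℕ → ℕ) (N : ℕ) (c : ℤ) : (coword U N c).length = N :=
  length_greedyDigits _ _ _

theorem coword_injOn (hU : IsPositionalSystem U) {N : ℕ} {c d : ℤ} (hc : 1 ≤ c) (hc' : c ≤ U N)
    (hd : 1 ≤ d) (hd' : d ≤ U N) (h : coword U N c = coword U N d) : c = d := by
  have := greedyDigits_injOn hU (by omega) (by omega) h
  omega

theorem sInf_lt_spec {x N : ℕ} (hx : x < U N) :
    x < U (sInf {l | x < U l}) ∧ sInf {l | x < U l} ≤ N :=
  ⟨Nat.sInf_mem (s := {l | x < U l}) ⟨N, hx⟩, Nat.sInf_le hx⟩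

theorem leftpad_rep (hU : IsPositionalSystem U) {x N : ℕ} (hx : x < U N) :
    (rep U x).leftpad N 0 = greedyDigits U N x := by
  obtain ⟨h1, h2⟩ := sInf_lt_spec hx
  rw [List.leftpad, rep, length_greedyDigits, ← greedyDigits_add_of_lt hU _ h1,
    Nat.add_sub_cancel' h2]

theorem rep_sub_one (hU : IsPositionalSystem U) (N : ℕ) :
    rep U (U N - 1) = coword U N 1 := by
  have hpos := hU.pos N
  obtain ⟨h1, h2⟩ := sInf_lt_spec (U := U) (x := U N - 1) (N := N) (by omega)
  have h3 : sInf {l | U N - 1 < U l} = N := by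
    refine le_antisymm h2 (le_of_not_gt fun hlt => ?_)
    have := hU.strictMono hlt
    omega
  rw [rep, h3, coword]
  congr 1
  omega

theorem repShift_eq (hU : IsPositionalSystem U) {p i c n : ℕ} (hc : 1 ≤ c)
    (hcU : c ≤ U (n * p - i)) : repShift U p i c n = coword U (n * p - i) c := by
  rw [repShift, leftpad_rep hU (by omega), coword]
  congr 1
  omega


/-! ### Growth of U and tails of the expansions of 1 -/

variable {p : ℕ} {β : ℕ → ℝ}

theorem IsAssociatedBase.pos (hβ : IsAssociatedBase U p β) : 0 < p := hβ.1

theorem IsAssociatedBase.tendsto_ratio (hβ : IsAssociatedBase U p β) (k : ℕ) :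
    Tendsto (fun n : ℕ => (U (n * p - k) : ℝ) / (U (n * p - k - 1) : ℝ)) atTop
      (𝓝 (β (k % p))) := by
  refine ((hβ.2 (k % p) (Nat.mod_lt _ hβ.pos)).comp (tendsto_sub_atTop_nat (k / p))).congr'
    (Eventually.of_forall fun n => ?_)
  have h : (n - k / p) * p - k % p = n * p - k := by
    have h1 := Nat.div_add_mod' k p
    rw [Nat.sub_mul]
    omega
  simp only [Function.comp_apply, h]

theorem IsAssociatedBase.one_le (hU : IsPositionalSystem U) (hβ : IsAssociatedBase U p β) (k : ℕ) :
    1 ≤ β (k % p) := by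
  refine ge_of_tendsto (hβ.tendsto_ratio k) (Eventually.of_forall fun n => ?_)
  rw [one_le_div (by exact_mod_cast hU.pos _)]
  exact_mod_cast hU.strictMono.monotone (Nat.sub_le _ _)

/-- If some quotient limit exceeds `1`, then `U` grows exponentially. -/
theorem IsAssociatedBase.exists_pow_le (hU : IsPositionalSystem U) (hβ : IsAssociatedBase U p β)
    {j : ℕ} (hj : j < p) (hj1 : 1 < β j) :
    ∃ b : ℝ, 1 < b ∧ ∃ n₀, ∀ q : ℕ, b ^ q ≤ U ((q + n₀) * p) := by
  obtain ⟨b, hb1, hb⟩ := exists_between hj1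
  obtain ⟨n₀, hn₀⟩ := eventually_atTop.1 ((hβ.2 j hj).eventually_const_lt hb)
  refine ⟨b, hb1, n₀, fun q => ?_⟩
  induction q with
  | zero => simpa using Nat.one_le_iff_ne_zero.2 (hU.pos _).ne'
  | succ q ih =>
    have h1 := hn₀ (q + 1 + n₀) (by omega)
    rw [lt_div_iff₀ (by exact_mod_cast hU.pos _)] at h1
    have h2 : (q + n₀) * p ≤ (q + 1 + n₀) * p - j - 1 := by
      have : (q + 1 + n₀) * p = (q + n₀) * p + p := by ring
      omega
    have h3 : (U ((q + n₀) * p) : ℝ) ≤ U ((q + 1 + n₀) * p - j - 1) := by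
      exact_mod_cast hU.strictMono.monotone h2
    have h4 : (U ((q + 1 + n₀) * p - j) : ℝ) ≤ U ((q + 1 + n₀) * p) := by
      exact_mod_cast hU.strictMono.monotone (Nat.sub_le _ _)
    calc b ^ (q + 1) = b * b ^ q := by ring
      _ ≤ b * U ((q + 1 + n₀) * p - j - 1) := by gcongr; exact ih.trans h3
      _ ≤ _ := h1.le.trans h4

/-- Exponential growth beats affine growth. The condition on `f` allows any position a bounded
distance below np, truncated subtraction included. -/
theorem IsAssociatedBase.tendsto_affine_div (hU : IsPositionalSystem U)
    (hβ : IsAssociatedBase U p β) (h1 : ∃ j < p, 1 < β j) (k : ℕ) {f : ℕ → ℕ}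
    (hf : ∀ n, n * p ≤ f n + k) (a c : ℝ) :
    Tendsto (fun n : ℕ => (a * n + c) / (U (f n) : ℝ)) atTop (𝓝 0) := by
  obtain ⟨j, hj, hj1⟩ := h1
  obtain ⟨b, hb, n₀, hb'⟩ := hβ.exists_pow_le hU hj hj1
  have hlim : Tendsto (fun n : ℕ => (|a| * ((n : ℝ) ^ 1 / b ^ n) + |c| * ((n : ℝ) ^ 0 / b ^ n)) *
      b ^ (n₀ + k)) atTop (𝓝 ((|a| * 0 + |c| * 0) * b ^ (n₀ + k))) :=
    (((tendsto_pow_const_div_const_pow_of_one_lt 1 hb).const_mul _).add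
      ((tendsto_pow_const_div_const_pow_of_one_lt 0 hb).const_mul _)).mul_const _
  simp only [mul_zero, add_zero, zero_mul] at hlim
  refine squeeze_zero_norm' ?_ hlim
  filter_upwards [eventually_ge_atTop (n₀ + k)] with n hn
  obtain ⟨q, rfl⟩ := Nat.exists_eq_add_of_le hn
  have hle : (q + n₀) * p ≤ f (n₀ + k + q) := by
    have h2 := hf (n₀ + k + q)
    have h3 : (n₀ + k + q) * p = (q + n₀) * p + k * p := by ring
    have := Nat.le_mul_of_pos_right k hβ.pos
    omega
  have hU' : b ^ q ≤ (U (f (n₀ + k + q)) : ℝ) :=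
    (hb' q).trans (by exact_mod_cast hU.strictMono.monotone hle)
  have hbq : 0 < b ^ q := by positivity
  have hbk : 0 < b ^ (n₀ + k) := by positivity
  rw [Real.norm_eq_abs, abs_div, Nat.abs_cast]
  calc |a * ((n₀ + k + q : ℕ) : ℝ) + c| / (U (f (n₀ + k + q)) : ℝ)
      ≤ (|a| * ((n₀ + k + q : ℕ) : ℝ) + |c|) / b ^ q := by
        gcongr
        refine (abs_add_le _ _).trans ?_
        rw [abs_mul, Nat.abs_cast]
    _ = _ := by
        rw [pow_add b (n₀ + k) q, pow_one, pow_zero]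
        field_simp

theorem greedyRem_nonneg (p : ℕ) (β : ℕ → ℝ) (i n : ℕ) : 0 ≤ greedyRem p β i n := by
  cases n with
  | zero => exact zero_le_one
  | succ n => exact Int.fract_nonneg _

theorem greedyRem_lt_one (p : ℕ) (β : ℕ → ℝ) (i : ℕ) {n : ℕ} (hn : 1 ≤ n) :
    greedyRem p β i n < 1 := by
  obtain ⟨n, rfl⟩ : ∃ k, n = k + 1 := ⟨n - 1, by omega⟩
  exact Int.fract_lt_one _

theorem digit_add_greedyRem (hU : IsPositionalSystem U) (hβ : IsAssociatedBase U p β) (i n : ℕ) :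
    (digit p β i n : ℝ) + greedyRem p β i (n + 1) = β ((i + n) % p) * greedyRem p β i n := by
  have h0 : 0 ≤ β ((i + n) % p) * greedyRem p β i n :=
    mul_nonneg (zero_le_one.trans (hβ.one_le hU _)) (greedyRem_nonneg _ _ _ _)
  rw [digit, greedyRem, natCast_floor_eq_intCast_floor h0]
  exact Int.floor_add_fract _

theorem digit_zero_pos (hU : IsPositionalSystem U) (hβ : IsAssociatedBase U p β) (i : ℕ) :
    1 ≤ digit p β i 0 := by
  rw [digit, Nat.one_le_floor_iff]
  simpa [greedyRem] using hβ.one_le hU i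

theorem FiniteExpansion.digit_eq_zero {i : ℕ} (h : FiniteExpansion p β i) {n : ℕ}
    (hn : expLength p β i ≤ n) : digit p β i n = 0 :=
  Nat.sInf_mem (s := {L | ∀ n, L ≤ n → digit p β i n = 0}) h n hn

theorem FiniteExpansion.one_le_expLength (hU : IsPositionalSystem U) (hβ : IsAssociatedBase U p β)
    {i : ℕ} (h : FiniteExpansion p β i) : 1 ≤ expLength p β i := by
  by_contra hlt
  have h1 := h.digit_eq_zero (n := 0) (by omega)
  have h2 := digit_zero_pos hU hβ i
  omega

theorem FiniteExpansion.one_le_last {i k : ℕ} (h : FiniteExpansion p β i)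
    (hk : expLength p β i = k + 1) :
    1 ≤ digit p β i k := by
  by_contra hlt
  have h0 : k ∈ {L | ∀ n, L ≤ n → digit p β i n = 0} := by
    intro n hn
    rcases hn.eq_or_lt with rfl | hn
    · omega
    · exact h.digit_eq_zero (by omega)
  have : expLength p β i ≤ k := Nat.sInf_le h0
  omega

/-- Once the digits vanish, each step only multiplies the remainder by some β ≥ 1, and each period
by at least some β_j > 1; a nonzero remainder would exceed 1. -/
theorem FiniteExpansion.greedyRem_eq_zero (hU : IsPositionalSystem U)
    (hβ : IsAssociatedBase U p β) (h1 : ∃ j < p, 1 < β j) {i : ℕ} (h : FiniteExpansion p β i) :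
    greedyRem p β i (expLength p β i) = 0 := by
  obtain ⟨j, hj, hj1⟩ := h1
  set L := expLength p β i with hL
  have hL1 : 1 ≤ L := h.one_le_expLength hU hβ
  have hstep : ∀ n, L ≤ n → greedyRem p β i (n + 1) = β ((i + n) % p) * greedyRem p β i n := by
    intro n hn
    rw [← digit_add_greedyRem hU hβ, h.digit_eq_zero hn]
    simp
  have hmono : ∀ n, L ≤ n → greedyRem p β i n ≤ greedyRem p β i (n + 1) := by
    intro n hn
    rw [hstep n hn]
    exact le_mul_of_one_le_left (greedyRem_nonneg _ _ _ _) (hβ.one_le hU _)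
  have hmono' : ∀ n m, L ≤ n → n ≤ m → greedyRem p β i n ≤ greedyRem p β i m := by
    intro n m hn hnm
    induction m, hnm using Nat.le_induction with
    | base => exact le_rfl
    | succ m hm ih => exact ih.trans (hmono m (hn.trans hm))
  have hperiod : ∀ n, L ≤ n → β j * greedyRem p β i n ≤ greedyRem p β i (n + p) := by
    intro n hn
    obtain ⟨m, hm1, hm2, hm3⟩ : ∃ m, n ≤ m ∧ m + 1 ≤ n + p ∧ (i + m) % p = j := by
      refine ⟨n + (j + p - (i + n) % p) % p, by omega, ?_, ?_⟩
      · have := Nat.mod_lt (j + p - (i + n) % p) hβ.pos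
        omega
      · have h1 := Nat.mod_lt (i + n) hβ.pos
        rw [← add_assoc, Nat.add_mod_mod]
        have h2 := Nat.div_add_mod (i + n) p
        rw [show i + n + (j + p - (i + n) % p) = j + p * ((i + n) / p + 1) by
          rw [mul_add, mul_one]; omega, Nat.add_mul_mod_self_left, Nat.mod_eq_of_lt hj]
    have h2 := hmono' (m + 1) (n + p) (by omega) hm2
    rw [hstep m (by omega), hm3] at h2
    refine le_trans ?_ h2
    have := hmono' n m hn hm1
    have : 0 ≤ β j := by linarith
    gcongr
  have hpow : ∀ q : ℕ, β j ^ q * greedyRem p β i L ≤ greedyRem p β i (L + q * p) := by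
    intro q
    induction q with
    | zero => simp
    | succ q ih =>
      have h2 := hperiod (L + q * p) (by omega)
      have h3 : L + (q + 1) * p = L + q * p + p := by ring
      rw [h3]
      refine le_trans ?_ h2
      rw [pow_succ, mul_comm _ (β j), mul_assoc]
      have : 0 ≤ β j := by linarith
      gcongr
  by_contra hne
  have hpos : 0 < greedyRem p β i L := lt_of_le_of_ne (greedyRem_nonneg _ _ _ _) (Ne.symm hne)
  obtain ⟨q, hq⟩ := pow_unbounded_of_one_lt (1 / greedyRem p β i L) hj1
  rw [div_lt_iff₀ hpos] at hq
  have h2 := greedyRem_lt_one p β i (n := L + q * p) (by omega)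
  have := hpow q
  linarith

/-- The tails of a finite expansion of `1`, evaluated in the system `U`. -/
theorem FiniteExpansion.tendsto_tail (hU : IsPositionalSystem U) (hβ : IsAssociatedBase U p β)
    (h1 : ∃ j < p, 1 < β j) {i : ℕ} (h : FiniteExpansion p β i) {a : ℕ}
    (ha : a ≤ expLength p β i) :
    Tendsto (fun n : ℕ => ((∑ l ∈ Finset.Ico a (expLength p β i),
      digit p β i l * U (n * p - i - l - 1) : ℕ) : ℝ) / (U (n * p - i - a) : ℝ)) atTop
      (𝓝 (greedyRem p β i a)) := by
  induction ha using Nat.decreasingInduction with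
  | self => simp [h.greedyRem_eq_zero hU hβ h1]
  | of_succ a ha ih =>
    have hβ0 : β ((i + a) % p) ≠ 0 := (zero_lt_one.trans_le (hβ.one_le hU _)).ne'
    -- Splitting off the digit t_a and dividing by U_{N-a}/U_{N-a-1} gives the limit (t_a +
    -- r_{a+1})/β_{i+a} = r_a.
    have h2 := (ih.const_add (digit p β i a : ℝ)).div (hβ.tendsto_ratio (i + a)) hβ0
    rw [digit_add_greedyRem hU hβ, mul_div_cancel_left₀ _ hβ0] at h2
    refine h2.congr fun n => ?_
    have hp1 : (U (n * p - i - a) : ℝ) ≠ 0 := by exact_mod_cast (hU.pos _).ne'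
    have hp2 : (U (n * p - i - a - 1) : ℝ) ≠ 0 := by exact_mod_cast (hU.pos _).ne'
    rw [Finset.sum_eq_sum_Ico_succ_bot (by omega)]
    simp only [Pi.div_apply, ← Nat.sub_sub]
    push_cast
    field_simp

/-! ### One pass of the greedy algorithm through a finite expansion -/

/-- The digits `t_{i,0} ⋯ t_{i,ℓ_i - 1}` of `d_i`. -/
noncomputable def upWord (p : ℕ) (β : ℕ → ℝ) (i : ℕ) : List ℕ :=
  (List.range (expLength p β i)).map (digit p β i)

/-- The digits of `d_i` with the last one decreased by `1`. -/
noncomputable def downDigit (p : ℕ) (β : ℕ → ℝ) (i l : ℕ) : ℕ :=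
  digit p β i l - if l + 1 = expLength p β i then 1 else 0

/-- The word `t_{i,0} ⋯ t_{i,ℓ_i - 2} (t_{i,ℓ_i - 1} - 1)`. -/
noncomputable def downWord (p : ℕ) (β : ℕ → ℝ) (i : ℕ) : List ℕ :=
  (List.range (expLength p β i)).map (downDigit p β i)

theorem delta_eq (U : ℕ → ℕ) (p : ℕ) (β : ℕ → ℝ) (i n : ℕ) :
    delta U p β i n = (U (n * p - i) : ℤ) -
      ((∑ l ∈ Finset.range (expLength p β i), digit p β i l * U (n * p - i - l - 1) : ℕ) : ℤ) := by
  rw [delta, Finset.range_eq_Ico]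
  push_cast
  congr 1
  have h := Finset.sum_Ico_add' (fun l => (digit p β i (l - 1) : ℤ) * (U (n * p - i - l) : ℤ)) 0
    (expLength p β i) 1
  rw [zero_add, Finset.Ico_add_one_right_eq_Icc] at h
  rw [← h]
  refine Finset.sum_congr rfl fun l _ => ?_
  rw [Nat.add_sub_cancel, Nat.sub_sub (n * p - i)]

/-- The last digit is nonzero and has weight U_{N-ℓ_i}, so one unit of it can be set apart. -/
theorem FiniteExpansion.sum_downDigit (U : ℕ → ℕ) {i : ℕ} (h : FiniteExpansion p β i) {a : ℕ} (ha : a < expLength p β i) (N : ℕ) :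
    ∑ l ∈ Finset.Ico a (expLength p β i), downDigit p β i l * U (N - l - 1) +
      U (N - expLength p β i) =
    ∑ l ∈ Finset.Ico a (expLength p β i), digit p β i l * U (N - l - 1) := by
  obtain ⟨k, hk⟩ : ∃ k, expLength p β i = k + 1 := ⟨expLength p β i - 1, by omega⟩
  have hlast := h.one_le_last hk
  rw [hk, Finset.sum_Ico_succ_top (by omega), Finset.sum_Ico_succ_top (by omega), add_assoc]
  congr 1
  · refine Finset.sum_congr rfl fun l hl => ?_
    rw [downDigit, if_neg (by rw [Finset.mem_Ico] at hl; omega), Nat.sub_zero]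
  · rw [downDigit, hk, if_pos rfl, ← Nat.sub_sub, Nat.sub_mul, one_mul]
    exact Nat.sub_add_cancel (Nat.le_mul_of_pos_left _ hlast)

section Step

variable {i : ℕ} {ν : ℕ → ℕ} {a b g d : ℤ}

/-- Divided by U_{N-k}, the tail tends to r_k, which is below 1 because k ≥ 1, and the affine term
tends to 0. -/
theorem FiniteExpansion.eventually_tail_lt (hU : IsPositionalSystem U)
    (hβ : IsAssociatedBase U p β) (h1 : ∃ j < p, 1 < β j) (h : FiniteExpansion p β i)
    (hν : Tendsto ν atTop atTop)
    (hgrow : ∀ k, ∀ a b : ℝ,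
      Tendsto (fun n : ℕ => (a * n + b) / (U (ν n * p - i - k) : ℝ)) atTop (𝓝 0))
    (a b : ℤ) : ∀ᶠ n : ℕ in atTop, ∀ k ∈ Finset.Icc 1 (expLength p β i),
      ((∑ l ∈ Finset.Ico k (expLength p β i),
        digit p β i l * U (ν n * p - i - l - 1) : ℕ) : ℤ) + (a * n + b) < U (ν n * p - i - k) := by
  refine (Finset.eventually_all _).2 fun k hk => ?_
  rw [Finset.mem_Icc] at hk
  have h2 := ((h.tendsto_tail hU hβ h1 hk.2).comp hν).add (hgrow k a b)
  rw [add_zero] at h2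
  filter_upwards [h2.eventually_lt_const (greedyRem_lt_one p β i hk.1)] with n hn
  simp only [Function.comp_apply] at hn
  rw [← add_div, div_lt_one (by exact_mod_cast hU.pos _)] at hn
  exact_mod_cast hn

/-- Since Δ < c, a unit U_{N-ℓ} is borrowed from the last digit, leaving U_{N-ℓ} - (c - Δ). The
tails stay below those of the full expansion, so the digits are greedy. -/
theorem FiniteExpansion.coword_down (hU : IsPositionalSystem U)
    (hβ : IsAssociatedBase U p β) (h1 : ∃ j < p, 1 < β j) (h : FiniteExpansion p β i)
    (hν : Tendsto ν atTop atTop)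
    (hgrow : ∀ k, ∀ a b : ℝ,
      Tendsto (fun n : ℕ => (a * n + b) / (U (ν n * p - i - k) : ℝ)) atTop (𝓝 0))
    (hδ : ∀ᶠ n : ℕ in atTop, delta U p β i (ν n) = g * n + d)
    (hc : ∀ᶠ n : ℕ in atTop, g * n + d < a * n + b) :
    ∀ᶠ n : ℕ in atTop, coword U (ν n * p - i) (a * n + b) =
      downWord p β i ++ coword U (ν n * p - i - expLength p β i) ((a - g) * n + (b - d)) := by
  have hlen := h.one_le_expLength hU hβ
  have hlarge := hν.eventually_ge_atTop (i + expLength p β i)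
  filter_upwards [h.eventually_tail_lt hU hβ h1 hν hgrow 0 0,
    h.eventually_tail_lt hU hβ h1 hν hgrow (a - g) (b - d), hδ, hc, hlarge]
    with n htail hsmall hδn hcn hνn
  have hN : expLength p β i ≤ ν n * p - i := by
    have := Nat.le_mul_of_pos_right (ν n) hβ.pos
    omega
  set N := ν n * p - i with hNdef
  set L := expLength p β i with hL
  rw [delta_eq, ← hNdef, ← hL] at hδn
  -- This keeps U_{N-ℓ} - (c - Δ) positive, so that `toNat` loses nothing.
  have hlast := hsmall L (Finset.mem_Icc.2 ⟨hlen, le_rfl⟩)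
  rw [Finset.Ico_self, Finset.sum_empty] at hlast
  have hsplit : (a - g) * n + (b - d) = (a * n + b) - (g * n + d) := by ring
  rw [hsplit] at hlast ⊢
  generalize a * (n : ℤ) + b = c at *
  generalize g * (n : ℤ) + d = δ at *
  have hsum := h.sum_downDigit U (a := 0) (by omega) N
  rw [← hL, ← Finset.range_eq_Ico] at hsum
  have key := greedyDigits_sum_add (U := U) (downDigit p β i) N L
    ((U (N - L) : ℤ) - (c - δ)).toNat hN (by
      intro k hk hkL
      rcases hkL.eq_or_lt with rfl | hkL
      · rw [Finset.Ico_self, Finset.sum_empty]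
        omega
      · have h3 := h.sum_downDigit U hkL N
        have h4 := htail k (Finset.mem_Icc.2 ⟨hk, hkL.le⟩)
        rw [← hL] at h3
        omega)
  rw [coword, coword, downWord, ← hL, ← key]
  congr 1
  omega

/-- Since c ≤ Δ, nothing is borrowed: the whole of d_i is written, and the small number Δ - c
remains. -/
theorem FiniteExpansion.coword_up (hU : IsPositionalSystem U)
    (hβ : IsAssociatedBase U p β) (h1 : ∃ j < p, 1 < β j) (h : FiniteExpansion p β i)
    (hν : Tendsto ν atTop atTop)
    (hgrow : ∀ k, ∀ a b : ℝ,
      Tendsto (fun n : ℕ => (a * n + b) / (U (ν n * p - i - k) : ℝ)) atTop (𝓝 0))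
    (hδ : ∀ᶠ n : ℕ in atTop, delta U p β i (ν n) = g * n + d)
    (hc : ∀ᶠ n : ℕ in atTop, a * n + b ≤ g * n + d) :
    ∀ᶠ n : ℕ in atTop, coword U (ν n * p - i) (a * n + b) =
      upWord p β i ++
        greedyDigits U (ν n * p - i - expLength p β i) ((g - a) * n + (d - b)).toNat := by
  have hlarge := hν.eventually_ge_atTop (i + expLength p β i)
  filter_upwards [h.eventually_tail_lt hU hβ h1 hν hgrow (g - a) (d - b), hδ, hc, hlarge]
    with n hsmall hδn hcn hνn
  have hN : expLength p β i ≤ ν n * p - i := by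
    have := Nat.le_mul_of_pos_right (ν n) hβ.pos
    omega
  set N := ν n * p - i with hNdef
  set L := expLength p β i with hL
  rw [delta_eq, ← hNdef, ← hL] at hδn
  have hsplit : (g - a) * n + (d - b) = (g * n + d) - (a * n + b) := by ring
  rw [hsplit] at hsmall ⊢
  generalize a * (n : ℤ) + b = c at *
  generalize g * (n : ℤ) + d = δ at *
  have key := greedyDigits_sum_add (U := U) (digit p β i) N L (δ - c).toNat hN (by
      intro k hk hkL
      have h3 := hsmall k (Finset.mem_Icc.2 ⟨hk, hkL⟩)
      omega)
  rw [coword, upWord, ← hL, ← key]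
  congr 1
  omega

end Step

/-- If all β_j were 1, every d_v would be 1 0 0 ⋯, so σ would be v ↦ v + 1 modulo p and i would lie
on a cycle, against s ≥ 1. -/
theorem IsAssociatedBase.exists_one_lt (hU : IsPositionalSystem U) (hβ : IsAssociatedBase U p β)
    {i s r : ℕ} (hi : i < p) (h : LeadsToCycle p β i s r) : ∃ j < p, 1 < β j := by
  by_contra! hle
  have hone : ∀ k, β (k % p) = 1 := fun k =>
    le_antisymm (hle _ (Nat.mod_lt _ hβ.pos)) (hβ.one_le hU k)
  have hrem : ∀ v n, greedyRem p β v (n + 1) = 0 := by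
    intro v n
    induction n with
    | zero => simp [greedyRem, hone]
    | succ n ih => rw [greedyRem, ih]; simp
  have hdig : ∀ v n, 1 ≤ n → digit p β v n = 0 := by
    intro v n hn
    obtain ⟨n, rfl⟩ : ∃ k, n = k + 1 := ⟨n - 1, by omega⟩
    rw [digit, hrem]
    simp
  have hfin : ∀ v, FiniteExpansion p β v := fun v => ⟨1, hdig v⟩
  have hlen : ∀ v, expLength p β v = 1 := fun v =>
    le_antisymm (Nat.sInf_le (hdig v)) ((hfin v).one_le_expLength hU hβ)
  have hvert : ∀ j, vertex p β i j = (i + j) % p := by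
    intro j
    induction j with
    | zero => simp [vertex, Nat.mod_eq_of_lt hi]
    | succ j ih =>
      rw [vertex, Function.iterate_succ_apply', ← vertex, ih, succVertex, hlen, Nat.mod_add_mod,
        add_assoc]
  refine h.2.2 0 h.1 p ⟨hβ.pos, fun _ _ => hfin _, ?_⟩
  rw [hvert, hvert, zero_add, Nat.add_mod_right, add_zero]


/-! ### Affine bounds and words of the form x y^k z -/

theorem eventually_le_affine {a : ℤ} (ha : 0 < a) (b m : ℤ) :
    ∀ᶠ n : ℕ in atTop, m ≤ a * n + b := by
  filter_upwards [eventually_ge_atTop (m - b).toNat] with n hn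
  have : m - b ≤ n := by omega
  nlinarith

theorem Eventually.add_nat {P : ℕ → Prop} (h : ∀ᶠ n in atTop, P n) (q : ℕ) :
    ∀ᶠ n in atTop, P (n + q) :=
  (tendsto_add_atTop_nat q).eventually h

theorem sum_range_add_eq_of_periodic {A : Type*} [AddCancelCommMonoid A] {f : ℕ → A} {s R : ℕ}
    (hf : ∀ j, s ≤ j → f (j + R) = f j) {j : ℕ} (hj : s ≤ j) :
    ∑ h ∈ Finset.range R, f (j + h) = ∑ h ∈ Finset.range R, f (s + h) := by
  induction j, hj using Nat.le_induction with
  | base => rfl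
  | succ j hj ih =>
    rw [← ih]
    have h1 := Finset.sum_range_succ (fun h => f (j + h)) R
    rw [Finset.sum_range_succ', hf j hj, add_zero] at h1
    simpa only [add_right_comm, add_assoc] using add_right_cancel h1

/-- From some point on, `f` runs through the words `x`, `x y`, `x y y`, ..., followed by `z`. -/
def EventuallyPowers (f : ℕ → List ℕ) : Prop :=
  ∃ (n₀ : ℕ) (x y z : List ℕ), ∀ n, f (n₀ + n) = x ++ (List.replicate n y).flatten ++ z

theorem EventuallyPowers.of_step {f : ℕ → List ℕ} {y : List ℕ}
    (h : ∀ᶠ n in atTop, f (n + 1) = y ++ f n) : EventuallyPowers f := by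
  obtain ⟨n₀, hn₀⟩ := eventually_atTop.1 h
  refine ⟨n₀, [], y, f n₀, fun n => ?_⟩
  induction n with
  | zero => simp
  | succ n ih =>
    rw [← add_assoc, hn₀ _ (by omega), ih, List.replicate_succ]
    simp

theorem EventuallyPowers.exists_ge {f : ℕ → List ℕ} (hf : EventuallyPowers f) (m : ℕ) :
    ∃ n₀, m ≤ n₀ ∧ ∃ x y z : List ℕ, ∀ n, f (n₀ + n) = x ++ (List.replicate n y).flatten ++ z := by
  obtain ⟨n₀, x, y, z, hf⟩ := hf
  refine ⟨n₀ + m, by omega, x ++ (List.replicate m y).flatten, y, z, fun n => ?_⟩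
  rw [add_assoc, hf, List.replicate_add, List.flatten_append]
  simp only [List.append_assoc]

theorem EventuallyPowers.of_append {f g : ℕ → List ℕ} {w : List ℕ} (hg : EventuallyPowers g)
    (h : ∀ᶠ n in atTop, f n = w ++ g n) : EventuallyPowers f := by
  obtain ⟨n₁, hn₁⟩ := eventually_atTop.1 h
  obtain ⟨n₀, hn, x, y, z, hg⟩ := hg.exists_ge n₁
  refine ⟨n₀, w ++ x, y, z, fun n => ?_⟩
  rw [hn₁ _ (by omega), hg]
  simp only [List.append_assoc]

/-! ### The descent along a path into a cycle -/

/-- The greedy algorithm on `U N - c`, for `N` in an arithmetic progression with difference `Q`: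
after `j` passes through finite expansions of `1` it has reached position `pos j n`, the next pass
changes an affine `c` by the affine function `slope j * n + intercept j`, and from the pass `s` on
everything repeats after `R` passes, which consume `Q` digits. -/
structure CyclicDescent (U : ℕ → ℕ) (s R Q : ℕ) where
  pos : ℕ → ℕ → ℕ
  up : ℕ → List ℕ
  down : ℕ → List ℕ
  slope : ℕ → ℤ
  intercept : ℕ → ℤ
  pos_succ : ∀ j, ∀ᶠ n in atTop, pos j (n + 1) = pos j n + Q
  pos_cycle : ∀ j, s ≤ j → ∀ᶠ n in atTop, pos (j + R) (n + 1) = pos j n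
  down_cycle : ∀ j, s ≤ j → down (j + R) = down j
  slope_cycle : ∀ j, s ≤ j → slope j = 0
  intercept_cycle : ∀ j, s ≤ j → intercept (j + R) = intercept j
  growth : ∀ j (a b : ℤ), ∀ᶠ n : ℕ in atTop, a * n + b < U (pos j n)
  step_down : ∀ j (a b : ℤ), (∀ᶠ n : ℕ in atTop, slope j * n + intercept j < a * n + b) →
    ∀ᶠ n : ℕ in atTop, coword U (pos j n) (a * n + b) =
      down j ++ coword U (pos (j + 1) n) ((a - slope j) * n + (b - intercept j))
  step_up : ∀ j (a b : ℤ), (∀ᶠ n : ℕ in atTop, a * n + b ≤ slope j * n + intercept j) →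
    ∀ᶠ n : ℕ in atTop, coword U (pos j n) (a * n + b) =
      up j ++ greedyDigits U (pos (j + 1) n) ((slope j - a) * n + (intercept j - b)).toNat

namespace CyclicDescent

variable {s R Q : ℕ} (X : CyclicDescent U s R Q)

/-- The total slope of `t` passes from the pass `j` on. -/
def sumSlope (j t : ℕ) : ℤ := ∑ h ∈ Finset.range t, X.slope (j + h)

/-- The total intercept of `t` passes from the pass `j` on. -/
def sumIntercept (j t : ℕ) : ℤ := ∑ h ∈ Finset.range t, X.intercept (j + h)

/-- The digits written by `t` downward passes from the pass `j` on. -/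
def downs (j t : ℕ) : List ℕ := ((List.range t).map fun h => X.down (j + h)).flatten

/-- The increase along one period of the cycle. -/
def gain : ℤ := X.sumIntercept s R

theorem sumSlope_of_le {j : ℕ} (hj : s ≤ j) (t : ℕ) : X.sumSlope j t = 0 :=
  Finset.sum_eq_zero fun h _ => X.slope_cycle _ (by omega)

theorem sumIntercept_period {j : ℕ} (hj : s ≤ j) : X.sumIntercept j R = X.gain :=
  sum_range_add_eq_of_periodic X.intercept_cycle hj

theorem sumIntercept_add (j t u : ℕ) :
    X.sumIntercept j (t + u) = X.sumIntercept j t + X.sumIntercept (j + t) u := by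
  simp only [sumIntercept, Finset.sum_range_add, add_assoc]

theorem sumIntercept_add_period {j : ℕ} (hj : s ≤ j) (t : ℕ) :
    X.sumIntercept j (t + R) = X.sumIntercept j t + X.gain := by
  rw [sumIntercept_add, X.sumIntercept_period (by omega)]

theorem sumIntercept_mul_period {j : ℕ} (hj : s ≤ j) (q : ℕ) :
    X.sumIntercept j (q * R) = q * X.gain := by
  induction q with
  | zero => simp [sumIntercept]
  | succ q ih =>
    rw [add_mul, one_mul, X.sumIntercept_add_period hj, ih]
    push_cast
    ring

/-- As long as the deficit is still at least 1 after each pass, all passes are downward ones. -/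
theorem descend {j t : ℕ} {a b : ℤ}
    (h : ∀ u, 1 ≤ u → u ≤ t →
      ∀ᶠ n : ℕ in atTop, 1 ≤ (a - X.sumSlope j u) * n + (b - X.sumIntercept j u)) :
    ∀ᶠ n : ℕ in atTop, coword U (X.pos j n) (a * n + b) =
      X.downs j t ++
        coword U (X.pos (j + t) n) ((a - X.sumSlope j t) * n + (b - X.sumIntercept j t)) := by
  induction t with
  | zero => simp [downs, sumSlope, sumIntercept]
  | succ t ih =>
    have hs1 : X.sumSlope j (t + 1) = X.sumSlope j t + X.slope (j + t) :=
      Finset.sum_range_succ _ _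
    have hs2 : X.sumIntercept j (t + 1) = X.sumIntercept j t + X.intercept (j + t) :=
      Finset.sum_range_succ _ _
    have hlast := h (t + 1) (by omega) le_rfl
    rw [hs1, hs2] at hlast
    filter_upwards [ih fun u hu hut => h u hu (by omega),
      X.step_down (j + t) (a - X.sumSlope j t) (b - X.sumIntercept j t) (by
        filter_upwards [hlast] with n hn
        linarith)] with n h1 h2
    rw [h1, h2, hs1, hs2, downs, downs, List.range_succ, sub_sub, sub_sub, add_assoc]
    simp

/-- A remainder which never becomes positive on the cycle. -/
def Persists (j : ℕ) (a b : ℤ) : Prop := 0 < a ∨ (a = 0 ∧ ∀ t, X.sumIntercept j t < b)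

variable {X}

theorem Persists.eventually {j : ℕ} {a b : ℤ} (h : X.Persists j a b) (t : ℕ) :
    ∀ᶠ n : ℕ in atTop, 1 ≤ a * n + (b - X.sumIntercept j t) := by
  rcases h with h | ⟨rfl, h⟩
  · exact eventually_le_affine h _ _
  · refine Eventually.of_forall fun n => ?_
    have := h t
    linarith

theorem Persists.succ {j : ℕ} (hj : s ≤ j) {a b : ℤ} (h : X.Persists j a b) :
    X.Persists j a (a + b - X.gain) := by
  rcases h with h | ⟨rfl, h⟩
  · exact Or.inl h
  · refine Or.inr ⟨rfl, fun t => ?_⟩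
    have := h (t + R)
    rw [X.sumIntercept_add_period hj] at this
    linarith

variable (X)

/-- A round of R passes leads from n + 1 to n. Rewriting a(n + 1) + b - gain in terms of n gives the
new constant term. -/
theorem descend_cycle {j : ℕ} (hj : s ≤ j) {a b : ℤ} (h : X.Persists j a b) :
    ∀ᶠ n : ℕ in atTop, coword U (X.pos j (n + 1)) (a * (n + 1 : ℕ) + b) =
      X.downs j R ++ coword U (X.pos j n) (a * n + (a + b - X.gain)) := by
  have h1 := X.descend (j := j) (t := R) (a := a) (b := b) fun u _ _ => by
    rw [X.sumSlope_of_le hj, sub_zero]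
    exact h.eventually u
  filter_upwards [Eventually.add_nat h1 1, X.pos_cycle j hj] with n hn hp
  rw [hn, hp, X.sumSlope_of_le hj, X.sumIntercept_period hj]
  congr 2
  push_cast
  ring

theorem descend_cycle_pow {j : ℕ} (hj : s ≤ j) {a b : ℤ} (h : X.Persists j a b) (q : ℕ) :
    ∀ᶠ n : ℕ in atTop, coword U (X.pos j (n + q)) (a * (n + q : ℕ) + b) =
      (List.replicate q (X.downs j R)).flatten ++
        coword U (X.pos j n) (a * n + (b + q * (a - X.gain))) := by
  induction q generalizing b with
  | zero => simp
  | succ q ih =>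
    filter_upwards [Eventually.add_nat (X.descend_cycle hj h) q, ih (h.succ hj)] with n h1 h2
    rw [← add_assoc, h1, h2, List.replicate_succ, List.flatten_cons, List.append_assoc]
    congr 4
    push_cast
    ring

theorem pos_add (j q : ℕ) : ∀ᶠ n in atTop, X.pos j (n + q) = X.pos j n + Q * q := by
  induction q with
  | zero => simp
  | succ q ih =>
    filter_upwards [ih, Eventually.add_nat (X.pos_succ j) q] with n h1 h2
    rw [← add_assoc, h2, h1]
    ring

theorem greedyDigits_pow (hU : IsPositionalSystem U) (j q : ℕ) (a b : ℤ) :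
    ∀ᶠ n : ℕ in atTop, greedyDigits U (X.pos j (n + q)) (a * (n + q : ℕ) + b).toNat =
      (List.replicate q (List.replicate Q 0)).flatten ++
        greedyDigits U (X.pos j n) (a * n + (b + q * a)).toNat := by
  filter_upwards [X.pos_add j q, X.growth j a (b + q * a)] with n h1 h2
  have h3 : a * ((n + q : ℕ) : ℤ) + b = a * n + (b + q * a) := by push_cast; ring
  have := hU.pos (X.pos j n)
  rw [h1, h3, greedyDigits_add_of_lt hU _ (by omega), List.flatten_replicate_replicate, mul_comm]

/-- `L` contains `coword U (pos j n) 1`, for large `n`, and no other word of this length. -/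
def IsLanguageAt (j : ℕ) (L : Language ℕ) : Prop :=
  ∀ᶠ n in atTop, coword U (X.pos j n) 1 ∈ L ∧
    ∀ w ∈ L, w.length = X.pos j n → w = coword U (X.pos j n) 1

variable {X}

/-- If the words of a regular language contain all powers of `y` at a fixed place, then the
continuations do not depend on the exponent. -/
theorem IsLanguageAt.exists_eq {j : ℕ} {L : Language ℕ} (hL : X.IsLanguageAt j L)
    (hreg : L.IsRegular) {u y : List ℕ} {v : ℕ → ℕ → List ℕ} {m : ℕ → ℕ}
    (hv : ∀ q n, (v q n).length = m n)
    (h : ∀ q, ∀ᶠ n in atTop,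
      coword U (X.pos j (n + q)) 1 = u ++ (List.replicate q y).flatten ++ v q n) :
    ∃ q q', q < q' ∧ ∀ᶠ n in atTop, v q n = v q' n := by
  obtain ⟨K, a, ha, hpump⟩ := hreg.exists_pump
  refine ⟨K, K + a, by omega, ?_⟩
  filter_upwards [h K, h (K + a), Eventually.add_nat hL K, Eventually.add_nat hL (K + a)]
    with n h1 h2 h3 h4
  -- The pumped word has K + a copies of y followed by the tail belonging to K. It has the length of
  -- the word of L with K + a copies, hence equals it.
  have h5 := hpump u y (v K n) K le_rfl (h1 ▸ h3.1)
  have h6 := congrArg List.length h2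
  rw [length_coword] at h6
  have h7 := h4.2 _ h5 (by rw [h6]; simp [hv])
  rw [h2] at h7
  exact List.append_cancel_left h7

/-- After q rounds the deficit at `X.pos j n` has constant term b + q(a - gain). Pumping makes the
words for two values of q coincide, and a word determines its deficit. -/
theorem IsLanguageAt.eq_gain (hU : IsPositionalSystem U) {j₀ j : ℕ} {L : Language ℕ}
    (hL : X.IsLanguageAt j₀ L) (hreg : L.IsRegular) (hj : s ≤ j) {a b : ℤ} (hp : X.Persists j a b)
    {u : List ℕ}
    (hu : ∀ᶠ n : ℕ in atTop, coword U (X.pos j₀ n) 1 = u ++ coword U (X.pos j n) (a * n + b)) :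
    a = X.gain := by
  obtain ⟨q, q', hq, h⟩ := hL.exists_eq hreg (u := u) (y := X.downs j R)
    (v := fun q n => coword U (X.pos j n) (a * n + (b + q * (a - X.gain))))
    (fun _ _ => length_coword _ _ _) (fun q => by
      filter_upwards [Eventually.add_nat hu q, X.descend_cycle_pow hj hp q] with n h1 h2
      rw [h1, h2, List.append_assoc])
  have hpos : ∀ q : ℕ, ∀ᶠ n : ℕ in atTop, 1 ≤ a * n + (b + q * (a - X.gain)) := by
    intro q
    rcases hp with hp | ⟨rfl, hp⟩
    · exact eventually_le_affine hp _ _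
    · refine Eventually.of_forall fun n => ?_
      have := hp (q * R)
      rw [X.sumIntercept_mul_period hj] at this
      linarith
  obtain ⟨n, h1, h2, h3, h4, h5⟩ := (h.and ((hpos q).and ((hpos q').and
    ((X.growth j a (b + q * (a - X.gain))).and
      (X.growth j a (b + q' * (a - X.gain))))))).exists
  have h6 := coword_injOn hU h2 h4.le h3 h5.le h1
  have h7 : ((q' : ℤ) - q) * (a - X.gain) = 0 := by linarith
  rcases mul_eq_zero.1 h7 with h8 | h8
  · omega
  · omega

/-- For a positive slope, U_N - 1 is written as the full expansion, a long block of zeros and a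
number growing linearly with n; pumping the zeros would make this number stationary. -/
theorem IsLanguageAt.slope_nonpos (hU : IsPositionalSystem U) {j : ℕ} {L : Language ℕ}
    (hL : X.IsLanguageAt j L) (hreg : L.IsRegular) : X.slope j ≤ 0 := by
  by_contra! hpos
  have hup := X.step_up j 0 1 (by
    simpa using eventually_le_affine hpos (X.intercept j) 1)
  simp only [zero_mul, zero_add, sub_zero] at hup
  obtain ⟨q, q', hq, h⟩ := hL.exists_eq hreg (u := X.up j) (y := List.replicate Q 0)
    (v := fun q n => greedyDigits U (X.pos (j + 1) n)
      (X.slope j * n + (X.intercept j - 1 + q * X.slope j)).toNat)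
    (fun _ _ => length_greedyDigits _ _ _) (fun q => by
      filter_upwards [Eventually.add_nat hup q,
        X.greedyDigits_pow hU (j + 1) q (X.slope j) (X.intercept j - 1)] with n h1 h2
      rw [h1, h2, List.append_assoc])
  obtain ⟨n, h1, h2, h3, h4, h5⟩ := (h.and
    ((eventually_le_affine hpos (X.intercept j - 1 + q * X.slope j) 1).and
    ((eventually_le_affine hpos (X.intercept j - 1 + q' * X.slope j) 1).and
    ((X.growth (j + 1) (X.slope j) (X.intercept j - 1 + q * X.slope j)).and
      (X.growth (j + 1) (X.slope j) (X.intercept j - 1 + q' * X.slope j)))))).exists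
  have h6 := greedyDigits_injOn hU (by omega) (by omega) h1
  have h7 : ((q' : ℤ) - q) * X.slope j = 0 := by
    have : X.slope j * n + (X.intercept j - 1 + q * X.slope j) =
      X.slope j * n + (X.intercept j - 1 + q' * X.slope j) := by omega
    linarith
  rcases mul_eq_zero.1 h7 with h8 | h8 <;> omega

/-- The negative slope gives the deficit a positive coefficient, and the later nonpositive slopes
can only increase it. So the descent reaches the cycle with coefficient -`sumSlope`, to which
`eq_gain` applies. -/
theorem IsLanguageAt.sumSlope_eq (hU : IsPositionalSystem U) {j t : ℕ} {L : Language ℕ}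
    (hL : X.IsLanguageAt j L) (hreg : L.IsRegular) (hjt : j + t = s) (hneg : X.slope j < 0)
    (hle : ∀ h, j < h → X.slope h ≤ 0) : X.sumSlope j t = -X.gain := by
  have hsum : ∀ u, 1 ≤ u → X.sumSlope j u < 0 := by
    intro u hu
    induction u, hu using Nat.le_induction with
    | base => simpa [sumSlope] using hneg
    | succ u hu ih =>
      have h1 : X.sumSlope j (u + 1) = X.sumSlope j u + X.slope (j + u) :=
        Finset.sum_range_succ _ _
      have := hle (j + u) (by omega)
      linarith
  have ht : 1 ≤ t := by
    by_contra h0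
    have := X.slope_cycle j (by omega)
    omega
  have h := X.descend (j := j) (t := t) (a := 0) (b := 1) fun u hu _ =>
    eventually_le_affine (by have := hsum u hu; omega) _ _
  simp only [zero_mul, zero_add, zero_sub] at h
  have := hL.eq_gain hU hreg (by omega) (Or.inl (by have := hsum t ht; omega)) h
  omega

variable (X)

/-- If the gain were negative, the partial sums of the intercepts would have a maximum. From there
on the constant deficit 1 stays positive forever, and `eq_gain` with coefficient 0 gives gain 0. -/
theorem gain_nonneg (hU : IsPositionalSystem U) (hR : 1 ≤ R)
    (h : ∀ j, s ≤ j → ∃ L, X.IsLanguageAt j L ∧ L.IsRegular) : 0 ≤ X.gain := by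
  by_contra! hneg
  obtain ⟨t₀, -, ht₀⟩ := Finset.exists_max_image (Finset.range R) (X.sumIntercept s)
    ⟨0, Finset.mem_range.2 hR⟩
  have hmax : ∀ t, X.sumIntercept s t ≤ X.sumIntercept s t₀ := by
    intro t
    induction t using Nat.strong_induction_on with
    | _ t ih =>
      by_cases ht : t < R
      · exact ht₀ t (Finset.mem_range.2 ht)
      · obtain ⟨u, rfl⟩ : ∃ u, t = u + R := ⟨t - R, by omega⟩
        rw [X.sumIntercept_add_period le_rfl]
        have := ih u (by omega)
        omega
  have hpers : X.Persists (s + t₀) 0 1 := by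
    refine Or.inr ⟨rfl, fun t => ?_⟩
    have := hmax (t₀ + t)
    rw [sumIntercept_add] at this
    omega
  obtain ⟨L, hL, hreg⟩ := h (s + t₀) (by omega)
  have := hL.eq_gain hU hreg (by omega) hpers (u := []) (by simp)
  omega

/-- Only the slopes `0` and `-gain < 0` occur from the pass `j` on, the latter being followed by
slopes `0` only. -/
def SlopeCondition (j : ℕ) : Prop :=
  X.slope j = 0 ∨ (X.slope j = -X.gain ∧ X.slope j < 0 ∧ ∀ h, j < h → h < s → X.slope h = 0)

variable {X}

theorem SlopeCondition.nonpos {j : ℕ} (h : X.SlopeCondition j) : X.slope j ≤ 0 := by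
  rcases h with h | h <;> omega

variable (X)

/-- Downward induction: a negative slope at j makes the slopes from j on sum to -gain, whereas a
later nonzero slope equals -gain already by itself. -/
theorem slopeCondition (hU : IsPositionalSystem U) {j : ℕ} (hj : j ≤ s)
    (h : ∀ k, j ≤ k → k < s → ∃ L, X.IsLanguageAt k L ∧ L.IsRegular) :
    ∀ k, j ≤ k → X.SlopeCondition k := by
  induction hj using Nat.decreasingInduction with
  | self => exact fun k hk => Or.inl (X.slope_cycle k hk)
  | of_succ j hj ih =>
    have ih := ih fun k hk => h k (by omega)
    intro k hk
    rcases hk.eq_or_lt with rfl | hk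
    · obtain ⟨L, hL, hreg⟩ := h j le_rfl hj
      rcases (hL.slope_nonpos hU hreg).eq_or_lt with h0 | hneg
      · exact Or.inl h0
      · obtain ⟨t, rfl⟩ : ∃ t, s = j + (t + 1) := ⟨s - j - 1, by omega⟩
        have hsum := hL.sumSlope_eq hU hreg rfl hneg fun k hk => (ih k hk).nonpos
        rw [sumSlope, Finset.sum_range_succ', add_zero] at hsum
        have hzero : ∀ k, j < k → k < j + (t + 1) → X.slope k = 0 := by
          intro k hk hkt
          by_contra hne
          have hk' : X.slope k = -X.gain := by
            rcases ih k hk with h0 | h0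
            · exact absurd h0 hne
            · exact h0.1
          -- The slopes after j would sum to at most -gain, leaving a nonnegative slope at j.
          have hle := Finset.single_le_sum (f := fun u => -X.slope (j + (u + 1)))
            (s := Finset.range t) (fun u _ => by
              have := (ih (j + (u + 1)) (by omega)).nonpos
              omega) (Finset.mem_range.2 (show k - j - 1 < t by omega))
          rw [Finset.sum_neg_distrib, show j + (k - j - 1 + 1) = k by omega] at hle
          omega
        rw [Finset.sum_eq_zero fun u hu => hzero _ (by omega)
          (by rw [Finset.mem_range] at hu; omega), zero_add] at hsum
        exact Or.inr ⟨hsum, hneg, hzero⟩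
    · exact ih k hk

theorem eventuallyPowers_greedyDigits (hU : IsPositionalSystem U) (j x : ℕ) :
    EventuallyPowers fun n => greedyDigits U (X.pos j n) x := by
  refine EventuallyPowers.of_step (y := List.replicate Q 0) ?_
  filter_upwards [X.pos_succ j, X.growth j 0 x] with n h1 h2
  rw [h1, greedyDigits_add_of_lt hU _ (by omega)]

theorem eventuallyPowers_of_le (hU : IsPositionalSystem U) {j : ℕ} {c : ℤ}
    (hj : X.slope j = 0) (hc : c ≤ X.intercept j) :
    EventuallyPowers fun n => coword U (X.pos j n) c := by
  refine (X.eventuallyPowers_greedyDigits hU (j + 1) (X.intercept j - c).toNat).of_append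
    (w := X.up j) ?_
  simpa [hj] using X.step_up j 0 c (Eventually.of_forall fun n => by simpa [hj] using hc)

theorem eventuallyPowers_of_lt {j : ℕ} {c : ℤ} (hj : X.slope j = 0) (hc : X.intercept j < c)
    (h : EventuallyPowers fun n => coword U (X.pos (j + 1) n) (c - X.intercept j)) :
    EventuallyPowers fun n => coword U (X.pos j n) c := by
  refine h.of_append (w := X.down j) ?_
  simpa [hj] using X.step_down j 0 c (Eventually.of_forall fun n => by simpa [hj] using hc)

theorem eventuallyPowers_cycle_of_le (hU : IsPositionalSystem U) (t : ℕ) {j : ℕ} (hj : s ≤ j)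
    {c : ℤ} (hc : 1 ≤ c) (h : c ≤ X.sumIntercept j t) :
    EventuallyPowers fun n => coword U (X.pos j n) c := by
  induction t generalizing j c with
  | zero => simp [sumIntercept] at h; omega
  | succ t ih =>
    rcases le_or_gt c (X.intercept j) with hle | hlt
    · exact X.eventuallyPowers_of_le hU (X.slope_cycle j hj) hle
    · refine X.eventuallyPowers_of_lt (X.slope_cycle j hj) hlt (ih (by omega) (by omega) ?_)
      rw [add_comm, sumIntercept_add] at h
      simp only [sumIntercept, Finset.sum_range_one, add_zero] at h ⊢
      omega

/-- If some partial sum reaches c, the descent stops in an upward pass, followed by zeros and a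
fixed number. Otherwise the gain is 0 and each round reproduces the deficit. -/
theorem eventuallyPowers_cycle (hU : IsPositionalSystem U) (hgain : 0 ≤ X.gain) {c : ℤ}
    (hc : 1 ≤ c) : EventuallyPowers fun n => coword U (X.pos s n) c := by
  by_cases h : ∃ t, c ≤ X.sumIntercept s t
  · obtain ⟨t, ht⟩ := h
    exact X.eventuallyPowers_cycle_of_le hU t le_rfl hc ht
  · push Not at h
    have h0 : X.gain = 0 := by
      refine le_antisymm ?_ hgain
      by_contra! hpos
      -- After c rounds, the partial sum is c times the gain, hence at least c.
      have := h (c.toNat * R)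
      rw [X.sumIntercept_mul_period le_rfl] at this
      have h1 : ((c.toNat : ℕ) : ℤ) = c := by omega
      rw [h1] at this
      nlinarith
    refine EventuallyPowers.of_step (y := X.downs s R) ?_
    simpa [h0] using X.descend_cycle le_rfl (Or.inr ⟨rfl, h⟩ : X.Persists s 0 c)

/-- With coefficient equal to the gain, the loss over a round cancels the shift from n + 1 to n, so
the deficit recurs exactly. -/
theorem eventuallyPowers_gain (hgain : 0 < X.gain) {j t : ℕ} (hjt : j + t = s)
    (h : ∀ k, j ≤ k → k < s → X.slope k = 0) (b : ℤ) :
    EventuallyPowers fun n => coword U (X.pos j n) (X.gain * n + b) := by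
  have hzero : ∀ u, u ≤ t → X.sumSlope j u = 0 := fun u hu =>
    Finset.sum_eq_zero fun k hk => h _ (by omega) (by rw [Finset.mem_range] at hk; omega)
  have hd := X.descend (j := j) (t := t) (a := X.gain) (b := b) fun u _ hu => by
    rw [hzero u hu, sub_zero]
    exact eventually_le_affine hgain _ _
  rw [hzero t le_rfl, sub_zero, hjt] at hd
  refine EventuallyPowers.of_append (EventuallyPowers.of_step (y := X.downs s R) ?_) hd
  filter_upwards [X.descend_cycle le_rfl
    (Or.inl hgain : X.Persists s X.gain (b - X.sumIntercept j t))] with n hn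
  rw [hn, add_sub_cancel_left]

theorem eventuallyPowers (hU : IsPositionalSystem U) (hgain : 0 ≤ X.gain) {j : ℕ} (hj : j ≤ s)
    (h : ∀ k, j ≤ k → X.SlopeCondition k) {c : ℤ} (hc : 1 ≤ c) :
    EventuallyPowers fun n => coword U (X.pos j n) c := by
  induction hj using Nat.decreasingInduction generalizing c with
  | self => exact X.eventuallyPowers_cycle hU hgain hc
  | of_succ j hj ih =>
    rcases h j le_rfl with h0 | ⟨h1, h2, h3⟩
    · rcases le_or_gt c (X.intercept j) with hle | hlt
      · exact X.eventuallyPowers_of_le hU h0 hle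
      · exact X.eventuallyPowers_of_lt h0 hlt (ih (fun k hk => h k (by omega)) (by omega))
    · refine (X.eventuallyPowers_gain (j := j + 1) (t := s - (j + 1)) (by omega) (by omega)
        (fun k hk => h3 k (by omega)) (c - X.intercept j)).of_append (w := X.down j) ?_
      have hd := X.step_down j 0 c (by
        filter_upwards [eventually_le_affine (a := -X.slope j) (by omega)
          (c - X.intercept j) 1] with n hn
        linarith)
      simpa [h1] using hd

end CyclicDescent


/-! ### Vertices, lengths and shifts along the path -/

theorem vertex_add (p : ℕ) (β : ℕ → ℝ) (i j h : ℕ) :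
    vertex p β i (j + h) = vertex p β (vertex p β i j) h := by
  rw [vertex, add_comm, Function.iterate_add_apply]
  rfl

theorem kLen_succ (p : ℕ) (β : ℕ → ℝ) (i j : ℕ) :
    kLen p β i (j + 1) = kLen p β i j + expLength p β (vertex p β i j) :=
  Finset.sum_range_succ _ _

theorem kLen_add (p : ℕ) (β : ℕ → ℝ) (i j h : ℕ) :
    kLen p β i (j + h) = kLen p β i j + kLen p β (vertex p β i j) h := by
  simp only [kLen, Finset.sum_range_add, vertex_add]

theorem mShift_add {i : ℕ} (hi : i < p) (j h : ℕ) :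
    mShift p β i (j + h) = mShift p β i j + mShift p β (vertex p β i j) h := by
  have h1 := vertex_add_mShift_mul p β i j hi
  rw [mShift, kLen_add, ← add_assoc, ← h1, add_right_comm, Nat.add_mul_div_right _ _ (by omega),
    add_comm, ← mShift]

namespace ReachesCycle

variable {i s r : ℕ}

theorem vertex_add_period (h : ReachesCycle p β i s r) {j : ℕ} (hj : s ≤ j) :
    vertex p β i (j + r) = vertex p β i j := by
  obtain ⟨k, rfl⟩ := Nat.exists_eq_add_of_le hj
  rw [add_right_comm, vertex_add, h.2.2, ← vertex_add]

theorem vertex_add_mul_period (h : ReachesCycle p β i s r) {j : ℕ} (hj : s ≤ j) (q : ℕ) :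
    vertex p β i (j + q * r) = vertex p β i j := by
  induction q with
  | zero => simp
  | succ q ih => rw [add_mul, one_mul, ← add_assoc, h.vertex_add_period (by omega), ih]

/-- Properties of the vertices up to the end of the first round of the cycle hold for all. -/
theorem forall_vertex (h : ReachesCycle p β i s r) {P : ℕ → Prop} {m : ℕ} (hm : m ≤ s)
    (hP : ∀ j, m ≤ j → j < s + r → P (vertex p β i j)) (j : ℕ) (hj : m ≤ j) :
    P (vertex p β i j) := by
  induction j using Nat.strong_induction_on with
  | _ j ih =>
    by_cases hlt : j < s + r
    · exact hP j hj hlt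
    · have := h.1
      obtain ⟨k, rfl⟩ : ∃ k, j = k + r := ⟨j - r, by omega⟩
      rw [h.vertex_add_period (by omega)]
      exact ih k (by omega) (by omega)

theorem kLen_mul_period (h : ReachesCycle p β i s r) {j : ℕ} (hj : s ≤ j) (q : ℕ) :
    kLen p β i (j + q * r) = kLen p β i j + q * kLen p β (vertex p β i s) r := by
  induction q with
  | zero => simp
  | succ q ih =>
    have h1 := sum_range_add_eq_of_periodic (f := fun j => expLength p β (vertex p β i j))
      (fun k hk => by rw [h.vertex_add_period hk]) (show s ≤ j + q * r by omega)
    rw [add_mul, one_mul, ← add_assoc, kLen_add, ih, add_mul, one_mul, ← add_assoc]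
    congr 1
    simpa only [kLen, ← vertex_add] using h1

end ReachesCycle

theorem exists_intercept {x : ℕ → ℤ} {g : ℤ}
    (h : ∀ᶠ n in atTop, x n - x (n - 1) = g) : ∃ d, ∀ᶠ n : ℕ in atTop, x n - g * n = d := by
  obtain ⟨N, hN⟩ := eventually_atTop.1 h
  refine ⟨x N - g * N, eventually_atTop.2 ⟨N, fun n hn => ?_⟩⟩
  induction n, hn using Nat.le_induction with
  | base => rfl
  | succ n hn ih =>
    have := hN (n + 1) (by omega)
    rw [Nat.add_sub_cancel] at this
    push_cast
    linarith

/-! ### The descent attached to a vertex and a residue class -/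

section Path

variable (U p β) (M i e : ℕ)

/-- The position `np - i - k_{i,j}`, for `n` in the residue class of `e` modulo `M`. -/
noncomputable def pathPos (j n : ℕ) : ℕ := (n * M + e) * p - (i + kLen p β i j)

/-- The values `(Δ_{σ^j(i)})_{n - m_{i,j}}`, for `n` in the residue class of `e` modulo `M`. -/
noncomputable def pathDelta (j n : ℕ) : ℤ :=
  delta U p β (vertex p β i j) (n * M + e - mShift p β i j)

/-- `Γ_{i,e,j}` for `j < s`, and `0` on the cycle. -/
noncomputable def pathSlope (s j : ℕ) : ℤ := if j < s then gamma U p β M i e j else 0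

/-- The constant term of the ultimately affine sequence `pathDelta`. -/
noncomputable def pathIntercept (s j : ℕ) : ℤ :=
  eventualValue fun n => pathDelta U p β M i e j n - pathSlope U p β M i e s j * n

variable {U p β M i e}

theorem pathPos_eq (hi : i < p) (j n : ℕ) :
    (n * M + e - mShift p β i j) * p - vertex p β i j = pathPos p β M i e j n := by
  rw [pathPos, ← vertex_add_mShift_mul p β i j hi, Nat.sub_mul, Nat.sub_sub, add_comm (_ * p)]

theorem pathPos_succ_vertex (j n : ℕ) :
    pathPos p β M i e (j + 1) n =
      pathPos p β M i e j n - expLength p β (vertex p β i j) := by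
  rw [pathPos, pathPos, kLen_succ, ← add_assoc, Nat.sub_sub]

theorem le_pathPos_sub_add (hM : 1 ≤ M) (j k n : ℕ) :
    n * p ≤ pathPos p β M i e j n - k + (i + kLen p β i j + k) := by
  have h1 : n * p ≤ (n * M + e) * p := by
    gcongr
    exact (Nat.le_mul_of_pos_right n hM).trans (Nat.le_add_right _ _)
  rw [pathPos]
  omega

theorem pathDelta_eventually {s : ℕ} (hM : 1 ≤ M)
    (hdiff : ∀ j, j < s → UltPeriodicDiff (delta U p β (vertex p β i j)) M)
    (hper : ∀ j, s ≤ j → UltPeriodic (delta U p β (vertex p β i j)) M) (j : ℕ) :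
    ∀ᶠ n : ℕ in atTop, pathDelta U p β M i e j n =
      pathSlope U p β M i e s j * n + pathIntercept U p β M i e s j := by
  have hex : ∃ d, ∀ᶠ n : ℕ in atTop,
      pathDelta U p β M i e j n - pathSlope U p β M i e s j * n = d := by
    by_cases hj : j < s
    · rw [pathSlope, if_pos hj]
      exact exists_intercept (gamma_spec U p β M i e j hM (hdiff j hj))
    · rw [pathSlope, if_neg hj]
      simpa [pathDelta] using (hper j (by omega)).exists_eventually hM e (mShift p β i j)
  obtain ⟨d, hd⟩ := hex
  rw [pathIntercept, eventualValue_eq hd]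
  filter_upwards [hd] with n hn
  linarith

variable {s r M' : ℕ}

/-- M' rounds of the cycle add M' k = Mp to the consumed length, hence M to the shift. -/
theorem mShift_period (hi : i < p) (h : ReachesCycle p β i s r)
    (hMM' : M * p = M' * kLen p β (vertex p β i s) r) {j : ℕ} (hj : s ≤ j) :
    mShift p β i (j + M' * r) = mShift p β i j + M := by
  rw [mShift, h.kLen_mul_period hj, ← hMM', ← add_assoc, Nat.add_mul_div_right _ _ (by omega),
    ← mShift]

/-- The greedy algorithm on `U_{np-i} - c`, for `n` in the residue class of `e` modulo `M`. -/
noncomputable def pathDescent (hU : IsPositionalSystem U) (hβ : IsAssociatedBase U p β)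
    (h1 : ∃ j < p, 1 < β j) (hi : i < p) (h : ReachesCycle p β i s r) (hM : 1 ≤ M)
    (hMM' : M * p = M' * kLen p β (vertex p β i s) r)
    (hdiff : ∀ j, j < s → UltPeriodicDiff (delta U p β (vertex p β i j)) M)
    (hper : ∀ j, s ≤ j → UltPeriodic (delta U p β (vertex p β i j)) M) (e : ℕ) :
    CyclicDescent U s (M' * r) (M * p) :=
  have hfin : ∀ j, FiniteExpansion p β (vertex p β i j) := fun j =>
    h.forall_vertex (Nat.zero_le s) (fun j _ => h.2.1 j) j (Nat.zero_le j)
  have hlim : ∀ j, Tendsto (fun n => n * M + e - mShift p β i j) atTop atTop := fun j =>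
    (tendsto_sub_atTop_nat _).comp
      (tendsto_atTop_mono (fun n => (Nat.le_mul_of_pos_right n hM).trans (Nat.le_add_right _ _))
        tendsto_id)
  have hgrow : ∀ j k (a b : ℝ), Tendsto (fun n : ℕ => (a * n + b) /
      (U ((n * M + e - mShift p β i j) * p - vertex p β i j - k) : ℝ)) atTop (𝓝 0) :=
    fun j k a b => by
      simp only [pathPos_eq hi]
      exact hβ.tendsto_affine_div hU h1 _ (le_pathPos_sub_add hM j k) a b
  { pos := pathPos p β M i e
    up := fun j => upWord p β (vertex p β i j)
    down := fun j => downWord p β (vertex p β i j)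
    slope := pathSlope U p β M i e s
    intercept := pathIntercept U p β M i e s
    pos_succ := fun j => by
      filter_upwards [eventually_ge_atTop (i + kLen p β i j)] with n hn
      have h2 := Nat.le_mul_of_pos_right n (Nat.mul_pos hM hβ.pos)
      have h3 : ((n + 1) * M + e) * p = n * (M * p) + e * p + M * p := by ring
      have h4 : (n * M + e) * p = n * (M * p) + e * p := by ring
      rw [pathPos, pathPos, h3, h4]
      omega
    pos_cycle := fun j hj => Eventually.of_forall fun n => by
      have h3 : ((n + 1) * M + e) * p = (n * M + e) * p + M * p := by ring
      rw [pathPos, pathPos, h.kLen_mul_period hj, ← hMM', h3]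
      omega
    down_cycle := fun j hj => by rw [h.vertex_add_mul_period hj]
    slope_cycle := fun j hj => if_neg (by omega)
    intercept_cycle := fun j hj => by
      -- Both intercepts are values of the same Δ at the same index: (n + 1)M + e - (m + M) = nM + e
      -- - m.
      have h2 := Eventually.add_nat
        (pathDelta_eventually (e := e) hM hdiff hper (j + M' * r)) 1
      obtain ⟨n, hn1, hn2⟩ := (h2.and (pathDelta_eventually (e := e) hM hdiff hper j)).exists
      rw [pathSlope, if_neg (by omega), zero_mul, zero_add] at hn1 hn2
      rw [← hn1, ← hn2, pathDelta, pathDelta, h.vertex_add_mul_period hj,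
        mShift_period hi h hMM' hj]
      congr 1
      rw [add_mul]
      omega
    growth := fun j a b => by
      have h2 := hβ.tendsto_affine_div hU h1 _
        (le_pathPos_sub_add (β := β) (i := i) (e := e) hM j 0) a b
      filter_upwards [h2.eventually_lt_const zero_lt_one] with n hn
      rw [div_lt_one (by exact_mod_cast hU.pos _)] at hn
      exact_mod_cast hn
    step_down := fun j a b hc => by
      simpa only [pathPos_eq hi, ← pathPos_succ_vertex] using
        (hfin j).coword_down hU hβ h1 (hlim j) (hgrow j) (pathDelta_eventually hM hdiff hper j) hc
    step_up := fun j a b hc => by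
      simpa only [pathPos_eq hi, ← pathPos_succ_vertex] using
        (hfin j).coword_up hU hβ h1 (hlim j) (hgrow j) (pathDelta_eventually hM hdiff hper j) hc }

end Path

/-! ### From descents back to the languages -/

theorem mem_lang_iff (hU : IsPositionalSystem U) {i : ℕ} {w : List ℕ} :
    w ∈ lang U p i ↔ ∃ n, 1 ≤ n ∧ w = coword U (n * p - i) 1 := by
  simp only [← rep_sub_one hU]
  rfl

theorem langShift_one (hU : IsPositionalSystem U) (i : ℕ) : langShift U p i 1 = lang U p i := by
  ext w
  rw [mem_lang_iff hU]
  constructor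
  · rintro ⟨n, hn, hc, rfl⟩
    exact ⟨n, hn, by rw [repShift_eq hU le_rfl hc, Nat.cast_one]⟩
  · rintro ⟨n, hn, rfl⟩
    exact ⟨n, hn, hU.pos _, by rw [repShift_eq hU le_rfl (hU.pos _), Nat.cast_one]⟩

/-- If the words `rep_{i,c}(n)` are eventually of the form `x y^k z` along each residue class
modulo `M`, then their language is regular. -/
theorem isRegular_langShift (hU : IsPositionalSystem U) {i c M : ℕ} (hi : i < p) (hc : 1 ≤ c)
    (hM : 1 ≤ M)
    (h : ∀ e < M, EventuallyPowers fun n => coword U ((n * M + e) * p - i) c) :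
    (langShift U p i c).IsRegular := by
  have hlarge : ∀ n, c + 1 ≤ n → c ≤ U (n * p - i) := by
    intro n hn
    refine le_trans ?_ (hU.strictMono.id_le _)
    obtain ⟨n, rfl⟩ : ∃ k, n = k + 1 := ⟨n - 1, by omega⟩
    have := Nat.le_mul_of_pos_right n (show 0 < p by omega)
    rw [add_mul, one_mul, id]
    omega
  choose! n₀ hn₀ x y z hf using fun e he => (h e he).exists_ge (c + 1)
  -- From B on, every n lies in the x y^k z regime of its residue class; the finitely many smaller n
  -- contribute singletons.
  set B := ((Finset.range M).sup n₀) * M with hB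
  have hfin : {n | n < B ∧ 1 ≤ n ∧ c ≤ U (n * p - i)}.Finite :=
    (Set.finite_lt_nat B).subset fun n hn => hn.1
  have hreg := (Language.IsRegular.biUnion hfin (fun n => {repShift U p i c n})
    fun n _ => Language.IsRegular.singleton _).add
    (Language.IsRegular.biUnion (Set.finite_lt_nat M)
      (fun e => Set.range fun n : ℕ => x e ++ (List.replicate n (y e)).flatten ++ z e)
      fun e _ => Language.IsRegular.range_flatten_replicate _ _ _)
  refine (congrArg Language.IsRegular (Language.ext fun w => ?_)).mp hreg
  refine (Language.mem_add _ _ w).trans ?_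
  constructor
  · rintro (hw | hw)
    · obtain ⟨n, ⟨-, hn1, hn2⟩, rfl⟩ := Set.mem_iUnion₂.1 hw
      exact ⟨n, hn1, hn2, rfl⟩
    · obtain ⟨e, he, n, rfl⟩ := Set.mem_iUnion₂.1 hw
      have hge : c + 1 ≤ (n₀ e + n) * M + e := by
        have h1 := Nat.le_mul_of_pos_right (n₀ e + n) hM
        have h2 := hn₀ e he
        omega
      refine ⟨(n₀ e + n) * M + e, by omega, hlarge _ hge, ?_⟩
      rw [repShift_eq hU hc (hlarge _ hge)]
      exact (hf e he n).symm
  · rintro ⟨n, hn1, hn2, rfl⟩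
    by_cases hn : n < B
    · exact Or.inl (Set.mem_iUnion₂.2 ⟨n, ⟨hn, hn1, hn2⟩, rfl⟩)
    · have he : n % M < M := Nat.mod_lt _ hM
      have h1 : n₀ (n % M) ≤ n / M :=
        (Finset.le_sup (Finset.mem_range.2 he)).trans
          ((Nat.le_div_iff_mul_le hM).2 (by omega))
      refine Or.inr (Set.mem_iUnion₂.2 ⟨n % M, he, n / M - n₀ (n % M), ?_⟩)
      have h2 := hf (n % M) he (n / M - n₀ (n % M))
      rw [Nat.add_sub_cancel' h1, Nat.div_add_mod'] at h2
      rw [repShift_eq hU hc hn2]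
      exact h2.symm

section Path

variable {M i e s r M' : ℕ} (hU : IsPositionalSystem U) (hβ : IsAssociatedBase U p β)
  (h1 : ∃ j < p, 1 < β j) (hi : i < p) (h : ReachesCycle p β i s r) (hM : 1 ≤ M)
  (hMM' : M * p = M' * kLen p β (vertex p β i s) r)
  (hdiff : ∀ j, j < s → UltPeriodicDiff (delta U p β (vertex p β i j)) M)
  (hper : ∀ j, s ≤ j → UltPeriodic (delta U p β (vertex p β i j)) M)

theorem pathDescent_isLanguageAt (e j : ℕ) :
    (pathDescent hU hβ h1 hi h hM hMM' hdiff hper e).IsLanguageAt j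
      (lang U p (vertex p β i j)) := by
  filter_upwards [eventually_ge_atTop (mShift p β i j + 1)] with n hn
  have h2 := Nat.le_mul_of_pos_right n hM
  change coword U (pathPos p β M i e j n) 1 ∈ _ ∧ ∀ w ∈ _, w.length = pathPos p β M i e j n →
    w = coword U (pathPos p β M i e j n) 1
  rw [← pathPos_eq hi]
  refine ⟨(mem_lang_iff hU).2 ⟨n * M + e - mShift p β i j, by omega, rfl⟩, fun w hw hlen => ?_⟩
  obtain ⟨k, -, rfl⟩ := (mem_lang_iff hU).1 hw
  rw [length_coword] at hlen
  rw [hlen]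

/-- Both sides add up the same values of the Δ's around the cycle, with n shifted by a constant that
does not affect ultimate values. -/
theorem pathDescent_gain (he : e < M) :
    (pathDescent hU hβ h1 hi h hM hMM' hdiff hper e).gain =
      deltaSumValue U p β M (vertex p β i s) (M' * r) (residue M e (mShift p β i s)) := by
  -- As e < M, the quotient of e - m_{i,s} by M is at most 0; its negative is the shift t.
  obtain ⟨t, ht⟩ : ∃ t : ℕ, residue M e (mShift p β i s) + mShift p β i s = t * M + e := by
    have hM0 : (0 : ℤ) < M := by exact_mod_cast hM
    have h3 := Int.emod_nonneg ((e : ℤ) - mShift p β i s) hM0.ne'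
    have h4 := Int.emod_add_mul_ediv ((e : ℤ) - mShift p β i s) M
    have h5 : ((residue M e (mShift p β i s) : ℕ) : ℤ) = ((e : ℤ) - mShift p β i s) % M :=
      Int.toNat_of_nonneg h3
    have h6 : ((e : ℤ) - mShift p β i s) / M ≤ 0 := by
      have : ((e : ℤ) - mShift p β i s) / M < 1 := Int.ediv_lt_of_lt_mul hM0 (by omega)
      omega
    refine ⟨(-(((e : ℤ) - mShift p β i s) / M)).toNat, ?_⟩
    zify
    rw [h5, Int.toNat_of_nonneg (by omega)]
    linarith
  refine (eventualValue_eq ?_).symm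
  have hall : ∀ᶠ n in atTop, ∀ k ∈ Finset.range (M' * r),
      pathDelta U p β M i e (s + k) (n + t) = pathIntercept U p β M i e s (s + k) := by
    refine (Finset.eventually_all _).2 fun k _ => Eventually.add_nat
      (P := fun n => pathDelta U p β M i e (s + k) n = pathIntercept U p β M i e s (s + k)) ?_ t
    simpa [pathSlope] using pathDelta_eventually (e := e) hM hdiff hper (s + k)
  filter_upwards [hall] with n hn
  refine Finset.sum_congr rfl fun k hk => ?_
  change _ = pathIntercept U p β M i e s (s + k)
  rw [← hn k hk, pathDelta, mShift_add hi, vertex_add]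
  congr 1
  rw [add_mul]
  omega

end Path

end NumerationSystem

/-! ### The main theorem -/

theorem mainTheorem4
    (U : ℕ → ℕ) (hU : IsPositionalSystem U)
    (p : ℕ) (β : ℕ → ℝ) (hβ : IsAssociatedBase U p β)
    (i : ℕ) (hi : i < p) (s r : ℕ) (hcycle : LeadsToCycle p β i s r)
    (hreg : ∀ j, 1 ≤ j → j < s + r → (lang U p (vertex p β i j)).IsRegular)
    (M M' : ℕ) (hM : 1 ≤ M) (hM' : 1 ≤ M')
    (hMM' : M * p = M' * kLen p β (vertex p β i s) r)
    (hdiff : ∀ j, j < s → UltPeriodicDiff (delta U p β (vertex p β i j)) M)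
    (hper : ∀ j, s ≤ j → j < s + r → UltPeriodic (delta U p β (vertex p β i j)) M) :
    List.TFAE [
      (lang U p i).IsRegular,
      ∀ c, 1 ≤ c → (langShift U p i c).IsRegular,
      ∀ e, e < M →
        gamma U p β M i e 0 = 0 ∨
        (gamma U p β M i e 0 =
            -deltaSumValue U p β M (vertex p β i s) (M' * r) (residue M e (mShift p β i s)) ∧
          gamma U p β M i e 0 < 0 ∧
          ∀ j, 1 ≤ j → j < s → gamma U p β M i e j = 0)] := by
  have h1 := hβ.exists_one_lt hU hi hcycle
  have hs := hcycle.1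
  have h := hcycle.2.1
  have hR : 1 ≤ M' * r := Nat.mul_pos hM' h.1
  have hreg' : ∀ j, 1 ≤ j → (lang U p (vertex p β i j)).IsRegular :=
    h.forall_vertex (P := fun v => (lang U p v).IsRegular) hs hreg
  have hper' : ∀ j, s ≤ j → UltPeriodic (delta U p β (vertex p β i j)) M :=
    h.forall_vertex (P := fun v => UltPeriodic (delta U p β v) M) le_rfl hper
  let X := pathDescent hU hβ h1 hi h hM hMM' hdiff hper'
  have hX : ∀ e j, (X e).IsLanguageAt j (lang U p (vertex p β i j)) :=
    pathDescent_isLanguageAt hU hβ h1 hi h hM hMM' hdiff hper'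
  have hcond : ∀ e, e < M → ((X e).SlopeCondition 0 ↔
      (gamma U p β M i e 0 = 0 ∨
        (gamma U p β M i e 0 =
            -deltaSumValue U p β M (vertex p β i s) (M' * r) (residue M e (mShift p β i s)) ∧
          gamma U p β M i e 0 < 0 ∧
          ∀ j, 1 ≤ j → j < s → gamma U p β M i e j = 0))) := by
    intro e he
    have hslope : ∀ j, j < s → (X e).slope j = gamma U p β M i e j := fun j hj => if_pos hj
    rw [CyclicDescent.SlopeCondition, hslope 0 hs,
      pathDescent_gain hU hβ h1 hi h hM hMM' hdiff hper' he]
    refine or_congr_right (and_congr_right fun _ => and_congr_right fun _ =>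
      forall_congr' fun j => forall_congr' fun _ => forall_congr' fun hj => ?_)
    rw [hslope j hj]
  tfae_have 1 → 3 := by
    intro hL e he
    refine (hcond e he).1 ((X e).slopeCondition hU (Nat.zero_le s) (fun k _ _ => ?_) 0 le_rfl)
    refine ⟨_, hX e k, ?_⟩
    rcases k.eq_zero_or_pos with rfl | hk
    · exact hL
    · exact hreg' k hk
  tfae_have 3 → 2 := by
    intro hΓ c hc
    refine isRegular_langShift hU hi hc hM fun e he => ?_
    have hgain := (X e).gain_nonneg hU hR fun j hj => ⟨_, hX e j, hreg' j (by omega)⟩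
    -- The slope conditions at the later vertices follow from the assumed regularity of their
    -- languages; condition (c) is needed at i only.
    have h2 := (X e).slopeCondition hU hs fun k hk _ => ⟨_, hX e k, hreg' k hk⟩
    refine (X e).eventuallyPowers hU hgain (Nat.zero_le s) (fun k _ => ?_)
      (show (1 : ℤ) ≤ c by exact_mod_cast hc)
    rcases k.eq_zero_or_pos with rfl | hk
    · exact (hcond e he).2 (hΓ e he)
    · exact h2 k hk
  tfae_have 2 → 1 := fun hc => langShift_one (p := p) hU i ▸ hc 1 le_rfl
  tfae_finish
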